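/- **Theorem (Normal form of rational quantum tori).** Let $K$ be any field and $n\in\mathbb N_0$. *Conventions.* An $n$-dimensional quantum torus over $K$ is a unital associative $\mathbb Z^n$-graded $K$-algebra $A=\bigoplus_{\gamma\in\mathbb Z^n}A_\gamma$ with all $A_\gamma$ one-dimensional and all non-zero elements of each $A_\gamma$ invertible. It is *rational* if the commutator group $C_A$ of $A^\times$ consists of (scalar multiples of $1$ by) roots of unity of $K$; then $C_A$ is viewed as a subgroup of $K^\times$. For $q\in K^\times$, $A_q$ is the quantum torus with basis $(\delta_\gamma)_{\gamma\in\mathbb Z^2}$ and product $\delta_\gamma\delta_{\gamma'}=q^{\gamma_1\gamma_2'}\delta_{\gamma+\gamma'}$. Algebras graded by $\Gamma$ and $\Gamma'$ are *graded isomorphic* if there are an algebra isomorphism $\varphi$ and a group isomorphism $\psi:\Gamma\to\Gamma'$ with $\varphi(A_\gamma)=A'_{\psi(\gamma)}$ for all $\gamma$; tensor products carry the product grading. For $m\ge 1$ put $Z:=\mathbb Z/m$, let $P\subseteq Z$ be the set of residue classes of the positive divisors of $m$, and write $a\mid b$ if $bZ\subseteq aZ$. For $h_1,\dots,h_s\in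 Z$ with $2s\le n$ let $N(h_1,\dots,h_s)\in M_n(Z)$ be the block diagonal matrix with blocks $\begin{pmatrix}0&h_i\\-h_i&0\end{pmatrix}$ followed by a zero block of size $n-2s$, and $$D_{(h_1,\dots,h_s)}:=\{\det g : g\in GL_n(Z),\ gN(h_1,\dots,h_s)g^\top=N(h_1,\dots,h_s)\}\subseteq Z^\times .$$ For $q\in K^\times$ of order $m$, *normal form data* $(s;h_1,\dots,h_s;z)$ consist of $s\in\mathbb N_0$ with $2s\le n$, elements $h_1=1\mid h_2\mid\cdots\mid h_s$ of $P\setminus\{0\}$ (so $s=0$ if $q=1$), and a unit $z\in Z^\times$, with $z=1$ if $2s<n$. They describe the algebra $$M=A_{q}\otimes A_{q^{h_2}}\otimes\cdots\otimes A_{q^{h_s}}\otimes K[\mathbb Z^{n-2s}]\ \text{ if } 2s<n,\qquad M=A_{q}\otimes A_{q^{h_2}}\otimes\cdots\otimes A_{q^{h_{s-1}}}\otimes A_{q^{zh_s}}\ \text{ if } 2s=n$$ (so $M=A_{q^z}$ if $n=2$, $s=1$; $M=K[\mathbb Z^n]$ if $s=0<n$; and $M=K$ if $n=0$). (a) For any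 rational $n$-dimensional quantum torus $A$ over $K$, the group $C_A\subseteq K^\times$ is cyclic. For every generator $q$ of $C_A$, the order of $q$ is finite, and there are normal form data as above with $A$ (graded) isomorphic to $M$. In particular $\operatorname{ord}(q^{zh_s})=\operatorname{ord}(q^{h_s})$ if $s\ge1$. (b) If two rational $n$-dimensional quantum tori $A$, $A'$ are isomorphic as algebras (in particular if they are graded isomorphic), then $C_A=C_{A'}$, and for every generator $q$ of this group both are described by normal form data related to the same $q$. (c) Let $A$, $A'$ be rational $n$-dimensional quantum tori with $C_A=C_{A'}=\langle q\rangle$, $\operatorname{ord}(q)=m$, isomorphic to the algebras described by data $(s;h_1,\dots,h_s;z)$ and $(s';h'_1,\dots,h'_{s'};z')$ for this $q$. Then $A$ and $A'$ are isomorphic as algebras, and equally are graded isomorphic, if and only if $$s=s',\qquad h_i=h_i'\ (i=2,\dots,s),\qquad z'\in\pm z\cdot D_{(1,h_2,\dots,h_s)} .$$ In this case $z^2h_s=(z')^2h_s$ in $Z$ (if $s\ge1$). -/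

import Mathlib

open scoped TensorProduct

noncomputable section

namespace RationalQuantumTori

universe u v w

/-! ### Quantum tori -/

section Graded

variable (K : Type u) [Field K]

/-- A `Γ`-quantum torus over `K`: a `Γ`-graded unital associative `K`-algebra all of whose
homogeneous components are one-dimensional, and all of whose non-zero homogeneous elements are
invertible. For `Γ = ℤⁿ` this is an `n`-dimensional quantum torus. -/
structure IsQuantumTorus {A : Type v} [Ring A] [Algebra K A] {Γ : Type w} [AddCommGroup Γ]
    [DecidableEq Γ] (𝒜 : Γ → Submodule K A) [GradedAlgebra 𝒜] : Prop where
  finrank_eq_one : ∀ γ, Module.finrank K (𝒜 γ) = 1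
  isUnit_of_mem : ∀ γ, ∀ a ∈ 𝒜 γ, a ≠ 0 → IsUnit a

/-- The embedding `Kˣ → Aˣ`, `ζ ↦ ζ · 1`. -/
def scalarUnits (A : Type v) [Ring A] [Algebra K A] : Kˣ →* Aˣ :=
  Units.map (algebraMap K A : K →* A)

/-- The commutator group `C_A` of the unit group `Aˣ`, viewed as a subgroup of `Kˣ`. -/
def commutatorGroup (A : Type v) [Ring A] [Algebra K A] : Subgroup Kˣ :=
  (commutator Aˣ).comap (scalarUnits K A)

/-- `A` is rational: the commutator group of `Aˣ` consists of roots of unity of `K`. -/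
def IsRational (A : Type v) [Ring A] [Algebra K A] : Prop :=
  ∀ u ∈ commutator Aˣ, ∃ ζ : Kˣ, IsOfFinOrder ζ ∧ scalarUnits K A ζ = u

variable {K}

/-- Graded isomorphy: an algebra isomorphism `φ : A → B` together with an isomorphism `ψ` of the
grading groups such that `φ(A_γ) = B_{ψ(γ)}`. -/
def GradedIsomorphic {A : Type v} [Ring A] [Algebra K A] {Γ : Type*} [AddCommGroup Γ]
    (𝒜 : Γ → Submodule K A) {B : Type w} [Ring B] [Algebra K B] {Δ : Type*} [AddCommGroup Δ]
    (ℬ : Δ → Submodule K B) : Prop :=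
  ∃ (φ : A ≃ₐ[K] B) (ψ : Γ ≃+ Δ), ∀ γ, (𝒜 γ).map φ.toLinearMap = ℬ (ψ γ)

end Graded

/-! ### The two-dimensional quantum torus `A_q` -/

/-- The `ℤ²`-quantum torus `A_q`: the vector space with basis `δ_γ`, `γ ∈ ℤ²`, and the product
`δ_γ δ_γ' = q ^ (γ₁ γ'₂) δ_{γ+γ'}`, i.e. the twisted group algebra of the biadditive cocycle `f`
with `f(e₁,e₂) = q` and `f(e₁,e₁) = f(e₂,e₂) = f(e₂,e₁) = 1`. -/
def PlaneTorus {K : Type u} [Field K] (_q : Kˣ) : Type u := (ℤ × ℤ) →₀ K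

namespace PlaneTorus

variable {K : Type u} [Field K] (q : Kˣ)

instance : AddCommGroup (PlaneTorus q) := inferInstanceAs (AddCommGroup ((ℤ × ℤ) →₀ K))

instance : Module K (PlaneTorus q) := inferInstanceAs (Module K ((ℤ × ℤ) →₀ K))

/-- The basis element `δ_γ`. -/
def delta (γ : ℤ × ℤ) : PlaneTorus q := Finsupp.single γ (1 : K)

/-- The basis `(δ_γ)`. -/
def basis : Module.Basis (ℤ × ℤ) K (PlaneTorus q) := Finsupp.basisSingleOne

theorem basis_apply (γ : ℤ × ℤ) : basis q γ = delta q γ :=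
  congrFun Finsupp.coe_basisSingleOne γ

/-- The bilinear product of `A_q`. -/
def mulMap : PlaneTorus q →ₗ[K] PlaneTorus q →ₗ[K] PlaneTorus q :=
  (basis q).constr K fun α => (basis q).constr K fun β =>
    ((q ^ (α.1 * β.2) : Kˣ) : K) • delta q (α + β)

theorem mulMap_delta (α β : ℤ × ℤ) :
    mulMap q (delta q α) (delta q β) = ((q ^ (α.1 * β.2) : Kˣ) : K) • delta q (α + β) := by
  rw [mulMap, ← basis_apply q α, Module.Basis.constr_basis, ← basis_apply q β,
    Module.Basis.constr_basis]

instance : Mul (PlaneTorus q) := ⟨fun a b => mulMap q a b⟩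

instance : One (PlaneTorus q) := ⟨delta q 0⟩

theorem mul_def (a b : PlaneTorus q) : a * b = mulMap q a b := rfl

theorem one_def : (1 : PlaneTorus q) = delta q 0 := rfl

theorem delta_mul_delta (α β : ℤ × ℤ) :
    delta q α * delta q β = ((q ^ (α.1 * β.2) : Kˣ) : K) • delta q (α + β) :=
  mulMap_delta q α β

private theorem assoc_aux (a b c : PlaneTorus q) : a * b * c = a * (b * c) := by
  have h1 : ∀ α β, mulMap q (mulMap q (delta q α) (delta q β)) =
      (mulMap q (delta q α)).comp (mulMap q (delta q β)) := fun α β => by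
    refine (basis q).ext fun γ => ?_
    simp only [basis_apply, LinearMap.comp_apply, mulMap_delta, map_smul, LinearMap.smul_apply,
      smul_smul, ← Units.val_mul, ← zpow_add, add_assoc]
    congr 3
    simp only [Prod.fst_add, Prod.snd_add]
    ring
  have h2 : ∀ α, ((mulMap q).flip c).comp (mulMap q (delta q α)) =
      (mulMap q (delta q α)).comp ((mulMap q).flip c) := fun α => by
    refine (basis q).ext fun β => ?_
    rw [basis_apply]
    exact congrArg (fun f => f c) (h1 α β)
  have h3 : ((mulMap q).flip c).comp ((mulMap q).flip b) =
      (mulMap q).flip (mulMap q b c) := by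
    refine (basis q).ext fun α => ?_
    rw [basis_apply]
    exact congrArg (fun f => f b) (h2 α)
  exact congrArg (fun f => f a) h3

private theorem one_mul_aux (a : PlaneTorus q) : 1 * a = a := by
  have h : mulMap q (delta q 0) = LinearMap.id := by
    refine (basis q).ext fun β => ?_
    simp [basis_apply, mulMap_delta]
  exact congrArg (fun f => f a) h

private theorem mul_one_aux (a : PlaneTorus q) : a * 1 = a := by
  have h : (mulMap q).flip (delta q 0) = LinearMap.id := by
    refine (basis q).ext fun β => ?_
    simp [basis_apply, mulMap_delta]
  exact congrArg (fun f => f a) h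

instance : Ring (PlaneTorus q) :=
  { (inferInstance : AddCommGroup (PlaneTorus q)), (inferInstance : Mul (PlaneTorus q)),
    (inferInstance : One (PlaneTorus q)) with
    mul_assoc := assoc_aux q
    one_mul := one_mul_aux q
    mul_one := mul_one_aux q
    left_distrib := fun a b c => map_add (mulMap q a) b c
    right_distrib := fun a b c => by rw [mul_def, mul_def, mul_def, map_add, LinearMap.add_apply]
    zero_mul := fun a => by rw [mul_def, map_zero, LinearMap.zero_apply]
    mul_zero := fun a => map_zero (mulMap q a) }

instance : Algebra K (PlaneTorus q) :=
  Algebra.ofModule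
    (fun r a b => by rw [mul_def, mul_def, map_smul, LinearMap.smul_apply])
    (fun r a b => by rw [mul_def, mul_def, map_smul])

end PlaneTorus

/-! ### Normal form data over `Z = ℤ/m` -/

/-- The standard representatives `P` of the multiplicative cosets of the unit group in `ℤ/m`:
the residue classes of the positive divisors `p₁^{j₁} ⋯ p_k^{j_k}` of `m` (for `m > 0`). -/
def cosetReps (m : ℕ) : Set (ZMod m) := {x | ∃ d : ℕ, d ∣ m ∧ x = (d : ZMod m)}

/-- The alternating block matrix `N(h₁,…,h_s)` of size `n ≥ 2s`, with diagonal blocks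
`(0, h_k; -h_k, 0)` followed by a zero block of size `n - 2s`. -/
def blockMatrix {R : Type*} [CommRing R] (n : ℕ) {s : ℕ} (h : Fin s → R) :
    Matrix (Fin n) (Fin n) R := fun i j =>
  ∑ k : Fin s,
    ((if i.val = 2 * k.val ∧ j.val = 2 * k.val + 1 then h k else 0) -
      (if i.val = 2 * k.val + 1 ∧ j.val = 2 * k.val then h k else 0))

/-- `D_{(h₁,…,h_s)}`: the determinants of the matrices `g ∈ GL_n(R)` with
`g N(h₁,…,h_s) gᵀ = N(h₁,…,h_s)`. -/
def detGroup {R : Type*} [CommRing R] (n : ℕ) {s : ℕ} (h : Fin s → R) : Set Rˣ :=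
  {d | ∃ g : Matrix.GeneralLinearGroup (Fin n) R,
    (g : Matrix (Fin n) (Fin n) R) * blockMatrix n h * (g : Matrix (Fin n) (Fin n) R).transpose
      = blockMatrix n h ∧ Matrix.GeneralLinearGroup.det g = d}

/-- Normal form data `(s; h₁ = 1, h₂, …, h_s; z)` over `ℤ/m` in dimension `n`. The index is
shifted: `h ⟨k, _⟩` is `h_{k+1}`. The unit `z` only matters for `2s = n`. -/
structure NormalFormData (n m : ℕ) where
  s : ℕ
  two_mul_le : 2 * s ≤ n
  h : Fin s → ZMod m
  h_first : ∀ i : Fin s, i.val = 0 → h i = 1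
  h_mem : ∀ i, h i ∈ cosetReps m
  h_ne_zero : ∀ i, h i ≠ 0
  h_dvd : ∀ i j : Fin s, i ≤ j → h i ∣ h j
  z : (ZMod m)ˣ
  z_eq_one : 2 * s < n → z = 1

namespace NormalFormData

variable {n m : ℕ} (d : NormalFormData n m)

/-- The exponents `h₁, …, h_{s-1}, z h_s`. -/
def exponent (i : Fin d.s) : ZMod m :=
  if i.val + 1 = d.s then (d.z : ZMod m) * d.h i else d.h i

variable {K : Type u} [Field K]

/-- The parameters `q^{h₁}, …, q^{h_{s-1}}, q^{z h_s}`, for `q` of order `m`. -/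
def param (q : Kˣ) (i : Fin d.s) : Kˣ := q ^ (d.exponent i).val

/-- The algebra `A_{q^{h₁}} ⊗ ⋯ ⊗ A_{q^{h_{s-1}}} ⊗ A_{q^{z h_s}} ⊗ K[ℤ^{n-2s}]`. For `2s = n`
the last factor is `K[ℤ⁰] = K`, and for `2s < n` one has `z = 1`. -/
abbrev Model (q : Kˣ) : Type u :=
  (⨂[K] i : Fin d.s, PlaneTorus (d.param q i)) ⊗[K] AddMonoidAlgebra K (Fin (n - 2 * d.s) → ℤ)

/-- The tensor product grading of `Model` by `(ℤ²)^s × ℤ^{n-2s} ≅ ℤⁿ`. -/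
def modelGrading (q : Kˣ) (γ : (Fin d.s → ℤ × ℤ) × (Fin (n - 2 * d.s) → ℤ)) :
    Submodule K (d.Model q) :=
  Submodule.span K {PiTensorProduct.tprod K (fun i => PlaneTorus.delta (d.param q i) (γ.1 i)) ⊗ₜ[K]
    AddMonoidAlgebra.single γ.2 (1 : K)}

/-- `s = s'`, `h_i = h_i'` for all `i`, and `z' ∈ ± z · D_{(1,h₂,…,h_s)}`. -/
def Related (d d' : NormalFormData n m) : Prop :=
  ∃ hs : d.s = d'.s, (∀ i : Fin d.s, d.h i = d'.h (Fin.cast hs i)) ∧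
    ∃ e ∈ detGroup n d.h, d'.z = d.z * e ∨ d'.z = -(d.z * e)

end NormalFormData

end RationalQuantumTori

end

noncomputable section

namespace RationalQuantumTori

/-! A non-zero element in each degree gives a basis with `b γ * b δ = c γ δ • b (γ + δ)`
(`IsTwistedBasis`), so a quantum torus is a twisted group algebra of ℤⁿ. All that matters is its
commutator pairing `c γ δ / c δ γ`, which is alternating and bimultiplicative. Since ℤⁿ has two
unique sums, every unit is a scalar multiple of a basis element. Hence the values of the pairing
generate the commutator group, and every algebra isomorphism is automatically graded and preserves
pairings (`exists_addEquiv_of_algEquiv`). Conversely, symmetric cocycles on free abelian groups are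
coboundaries (`exists_coboundary`), so tori with the same pairing are isomorphic.

Finitely many values determine the pairing, so rationality makes the commutator group finite, hence
cyclic. If q generates it and has order m, the pairing is q ^ (xᵀ M y) for an alternating matrix M
over ℤ/m that no non-zero scalar kills, and isomorphism becomes congruence of such matrices under
GL_n(ℤ) (`IsTwistedBasis.nonempty_algEquiv_iff`).

The image of GL_n(ℤ) in GL_n(ℤ/m) consists of the matrices of determinant ±1 (`mem_range_reduceGL`).
Integral symplectic reduction and diagonal scaling bring M to N(h), except that the determinant
condition may leave a unit z in the last block when 2s = n (`exists_congruence_exponent`). Even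
under all of GL_n(ℤ/m), the kernel sizes of the multiples a • N determine h
(`annihilator_eq_of_prod_card_eq`). What remains of z is its class modulo ±1 and the determinants of
the stabiliser of N(h). These determinants e satisfy e² h_s = h_s when 2s = n, which gives the final
relation (`sq_mul_eq_of_mem_detGroup`). -/

/-! ### Lifting matrices of determinant `±1` from `ℤ/m` to `ℤ` -/

section Lift

open Matrix

variable {n : Type*} [Fintype n] [DecidableEq n]

/-- The invertible diagonal matrix with the given diagonal entries. -/
def diagGL (R : Type*) [CommRing R] : (n → Rˣ) →* GL n R :=
  (Units.map (diagonalRingHom n R : (n → R) →* Matrix n n R)).comp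
    (MulEquiv.piUnits (M := fun _ : n => R)).symm.toMonoidHom

@[simp]
theorem coe_diagGL {R : Type*} [CommRing R] (u : n → Rˣ) :
    (diagGL R u : Matrix n n R) = diagonal fun i => (u i : R) := rfl

theorem det_diagGL {R : Type*} [CommRing R] (u : n → Rˣ) :
    GeneralLinearGroup.det (diagGL R u) = ∏ i, u i := by
  ext
  simp

/-- Reduction modulo `m`. -/
abbrev reduceGL (m : ℕ) : GL n ℤ →* GL n (ZMod m) :=
  GeneralLinearGroup.map (Int.castRingHom (ZMod m))

/-- An elementary matrix, as an element of the general linear group. -/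
def transvectionGL {R : Type*} [CommRing R] {i j : n} (h : i ≠ j) (c : R) : GL n R where
  val := transvection i j c
  inv := transvection i j (-c)
  val_inv := by simp [transvection_mul_transvection_same _ _ h]
  inv_val := by simp [transvection_mul_transvection_same _ _ h]

theorem transvectionGL_mem_range (m : ℕ) {i j : n} (h : i ≠ j) (c : ZMod m) :
    transvectionGL h c ∈ (reduceGL (n := n) m).range := by
  obtain ⟨c, rfl⟩ := ZMod.intCast_surjective c
  refine ⟨transvectionGL h c, ?_⟩
  ext a b
  simp only [GeneralLinearGroup.map_apply, transvectionGL, transvection, Matrix.add_apply, map_add,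
    one_apply, single_apply]
  split_ifs <;> simp

/-- Whitehead's identity. On the coordinates i, j the first three factors multiply to the monomial
matrix (0, u; -u⁻¹, 0), and the last three to the inverse of its value at u = 1. -/
theorem diagGL_mulSingle_mul_mulSingle_inv {R : Type*} [CommRing R] {i j : n} (h : i ≠ j)
    (u : Rˣ) :
    diagGL R (Pi.mulSingle i u * Pi.mulSingle j u⁻¹) =
      transvectionGL h (u : R) * transvectionGL h.symm (-(u⁻¹ : Rˣ) : R) *
        transvectionGL h (u : R) *
        (transvectionGL h (-1) * transvectionGL h.symm 1 * transvectionGL h (-1)) := by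
  have e : (diagonal fun k => ((Pi.mulSingle i u * Pi.mulSingle j u⁻¹ : n → Rˣ) k : R)) =
      1 + single i i ((u : R) - 1) + single j j ((u⁻¹ : Rˣ) - 1 : R) := by
    ext a b
    by_cases hab : a = b
    · subst hab
      by_cases ha : a = i
      · subst ha; simp [h, h.symm]
      · by_cases hb : a = j
        · subst hb; simp [ha, Ne.symm ha]
        · simp [ha, hb, Ne.symm ha, Ne.symm hb]
    · simp only [diagonal_apply_ne _ hab, Matrix.add_apply, one_apply_ne hab, single_apply]
      grind
  ext1
  rw [coe_diagGL, e]
  simp only [Units.val_mul, transvectionGL, transvection, mul_add, add_mul, one_mul, mul_one,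
    single_mul_single_same, single_mul_single_of_ne, h, h.symm, ne_eq, not_false_eq_true, add_zero,
    mul_neg, Units.mul_inv, Units.inv_mul, neg_mul, neg_neg]
  ext a b
  simp only [Matrix.add_apply, single_apply]
  split_ifs <;> simp <;> ring

theorem diagGL_mem_range (m : ℕ) (u : n → (ZMod m)ˣ) (hu : ∏ i, u i = 1 ∨ ∏ i, u i = -1) :
    diagGL (ZMod m) u ∈ (reduceGL (n := n) m).range := by
  rcases isEmpty_or_nonempty n with hn | ⟨⟨o⟩⟩
  · have : diagGL (ZMod m) u = 1 := Subsingleton.elim _ _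
    exact this ▸ one_mem _
  -- The whole determinant is moved to the coordinate o. The remaining factors have entries u i, (u
  -- i)⁻¹ and are products of transvections, which lift.
  have hsplit : u = (∏ i, (Pi.mulSingle i (u i) * Pi.mulSingle o (u i)⁻¹)) *
      Pi.mulSingle o (∏ i, u i) := by
    have h1 : ∏ i, (Pi.mulSingle o (u i)⁻¹ : n → (ZMod m)ˣ) =
        Pi.mulSingle o (∏ i, (u i)⁻¹) :=
      (map_prod (MonoidHom.mulSingle (fun _ : n => (ZMod m)ˣ) o) _ _).symm
    rw [Finset.prod_mul_distrib, Finset.univ_prod_mulSingle, h1, Finset.prod_inv_distrib,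
      Pi.mulSingle_inv, inv_mul_cancel_right]
  change u ∈ (reduceGL (n := n) m).range.comap (diagGL (ZMod m))
  rw [hsplit]
  refine mul_mem (Subgroup.prod_mem _ fun i _ => ?_) ?_
  · rcases eq_or_ne i o with rfl | hi
    · rw [← Pi.mulSingle_mul, mul_inv_cancel, Pi.mulSingle_one]
      exact one_mem _
    · rw [Subgroup.mem_comap, diagGL_mulSingle_mul_mulSingle_inv hi]
      refine mul_mem (mul_mem (mul_mem ?_ ?_) ?_) (mul_mem (mul_mem ?_ ?_) ?_) <;>
        apply transvectionGL_mem_range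
  · rcases hu with hu | hu
    · rw [hu, Pi.mulSingle_one]
      exact one_mem _
    · rw [hu]
      refine ⟨diagGL ℤ (Pi.mulSingle o (-1)), ?_⟩
      ext a b
      simp only [GeneralLinearGroup.map_apply, coe_diagGL, diagonal_apply, Pi.mulSingle_apply]
      split_ifs <;> simp

/-- Since M is injective, its image is a sublattice of full rank. A basis of ℤⁿ adapted to the
image, and the preimage under M of the corresponding basis of the image, make M diagonal. -/
theorem exists_smith_form {M : Matrix n n ℤ} (hM : M.det ≠ 0) :
    ∃ (U V : GL n ℤ) (a : n → ℤ), M = U * diagonal a * V := by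
  classical
  set f := toLin' M with hf
  have hinj : Function.Injective f := by
    rw [hf, ← LinearMap.ker_eq_bot]
    refine LinearMap.ker_eq_bot'.mpr fun x hx => ?_
    by_contra h0
    exact hM (exists_mulVec_eq_zero_iff.mp ⟨x, h0, hx⟩)
  obtain ⟨b', a, ab', h⟩ := Submodule.exists_smith_normal_form_of_rank_eq (Pi.basisFun ℤ n)
    (N := LinearMap.range f) (LinearMap.finrank_range_of_inj hinj)
  let e := LinearEquiv.ofInjective f hinj
  let c := ab'.map e.symm
  have hc : ∀ i, f (c i) = a i • b' i := fun i => by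
    rw [← h i]
    have : (e (c i) : n → ℤ) = f (c i) := rfl
    rw [← this]
    simp [c]
  have hD : LinearMap.toMatrix c b' f = diagonal a := by
    ext i j
    rw [LinearMap.toMatrix_apply, hc, map_smul, Module.Basis.repr_self, Finsupp.smul_apply,
      Finsupp.single_apply, diagonal_apply]
    by_cases h : i = j
    · subst h; simp
    · simp [h, Ne.symm h]
  let s := Pi.basisFun ℤ n
  refine ⟨⟨s.toMatrix b', b'.toMatrix s, s.toMatrix_mul_toMatrix_flip b',
    b'.toMatrix_mul_toMatrix_flip s⟩, ⟨c.toMatrix s, s.toMatrix c, c.toMatrix_mul_toMatrix_flip s,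
    s.toMatrix_mul_toMatrix_flip c⟩, a, ?_⟩
  rw [← hD]
  simp only [basis_toMatrix_mul_linearMap_toMatrix_mul_basis_toMatrix]
  rw [LinearMap.toMatrix_eq_toMatrix', hf, LinearMap.toMatrix'_toLin']

theorem det_reduceGL (m : ℕ) (G : GL n ℤ) :
    GeneralLinearGroup.det (reduceGL m G) = 1 ∨ GeneralLinearGroup.det (reduceGL m G) = -1 := by
  rw [show GeneralLinearGroup.det (reduceGL m G) =
    Units.map (Int.castRingHom (ZMod m) : ℤ →* ZMod m) (GeneralLinearGroup.det G) from
    GeneralLinearGroup.map_det _ _]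
  rcases Int.units_eq_one_or (GeneralLinearGroup.det G) with h | h <;> rw [h]
  · left; simp
  · right; ext; simp

/-- Matrices over `ℤ/m` of determinant `±1` lift to invertible integral matrices. -/
theorem mem_range_reduceGL (m : ℕ) (g : GL n (ZMod m))
    (hg : GeneralLinearGroup.det g = 1 ∨ GeneralLinearGroup.det g = -1) :
    g ∈ (reduceGL (n := n) m).range := by
  rcases subsingleton_or_nontrivial (ZMod m) with h1 | h1
  · have : g = 1 := by
      ext i j
      exact Subsingleton.elim _ _
    exact this ▸ one_mem _
  -- Any entrywise lift will do: its determinant reduces to a unit of a nontrivial ring, so it is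
  -- non-zero and has a Smith form. The diagonal part then has unit entries modulo m with product
  -- ±1.
  choose r hr using ZMod.intCast_surjective (n := m)
  set M : Matrix n n ℤ := Matrix.of fun i j => r ((g : Matrix n n (ZMod m)) i j)
  have hM : M.map (Int.castRingHom (ZMod m)) = g := by
    ext i j
    simp [M, hr]
  have hdet : ((M.det : ℤ) : ZMod m) = (GeneralLinearGroup.det g : ZMod m) := by
    have := (Int.castRingHom (ZMod m)).map_det M
    rw [RingHom.mapMatrix_apply, hM] at this
    exact this
  have hne : M.det ≠ 0 := by
    intro h0
    rw [h0, Int.cast_zero] at hdet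
    exact (GeneralLinearGroup.det g).ne_zero hdet.symm
  obtain ⟨U, V, a, hUV⟩ := exists_smith_form hne
  have hD : diagonal (fun i => ((a i : ℤ) : ZMod m)) =
      ((reduceGL m U⁻¹ * g * reduceGL m V⁻¹ : GL n (ZMod m)) : Matrix n n (ZMod m)) := by
    have h2 : (g : Matrix n n (ZMod m)) = (reduceGL m U : GL n (ZMod m)) *
        diagonal (fun i => ((a i : ℤ) : ZMod m)) * (reduceGL m V : GL n (ZMod m)) := by
      have := congrArg (Int.castRingHom (ZMod m)).mapMatrix hUV
      rw [map_mul, map_mul, RingHom.mapMatrix_apply, hM] at this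
      rw [this]
      congr 2
      simp [diagonal_map]
    rw [Units.val_mul, Units.val_mul, h2, map_inv, map_inv]
    simp only [mul_assoc, Units.mul_inv, mul_one]
    rw [← mul_assoc, Units.inv_mul, one_mul]
  set g' := reduceGL m U⁻¹ * g * reduceGL m V⁻¹ with hg'
  have hau : ∀ i, IsUnit ((a i : ℤ) : ZMod m) := by
    have : IsUnit (∏ i, ((a i : ℤ) : ZMod m)) := by
      rw [← det_diagonal, hD]
      exact (GeneralLinearGroup.det g').isUnit
    intro i
    exact isUnit_of_dvd_unit
      (Finset.dvd_prod_of_mem (fun i => ((a i : ℤ) : ZMod m)) (Finset.mem_univ i)) this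
  choose w hw using hau
  have hg'w : diagGL (ZMod m) w = g' := by
    ext1
    rw [coe_diagGL, ← hD]
    simp [hw]
  have hw' : diagGL (ZMod m) w ∈ (reduceGL (n := n) m).range := by
    apply diagGL_mem_range
    rw [← det_diagGL, hg'w, hg', map_mul, map_mul]
    rcases det_reduceGL m U⁻¹ with h | h <;> rcases det_reduceGL m V⁻¹ with h' | h' <;>
      rcases hg with hg | hg <;> rw [h, h', hg] <;> simp
  have : g = reduceGL m U * g' * reduceGL m V := by
    rw [hg', map_inv, map_inv]
    group
  rw [this, ← hg'w]
  exact mul_mem (mul_mem ⟨_, rfl⟩ hw') ⟨_, rfl⟩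

end Lift

/-! ### Block matrices -/

section Block

open Matrix

variable {R : Type*} [CommRing R] {n s : ℕ} (h : Fin s → R)

theorem blockMatrix_even {i : Fin n} {k : Fin s} (hi : i.val = 2 * k.val) (j : Fin n) :
    blockMatrix n h i j = if j.val = 2 * k.val + 1 then h k else 0 := by
  rw [blockMatrix, Finset.sum_eq_single k]
  · have : ¬ i.val = 2 * k.val + 1 := by omega
    simp [hi]
  · intro l _ hl
    have h1 : ¬ i.val = 2 * l.val := fun e => hl (Fin.ext (by omega))
    have h2 : ¬ i.val = 2 * l.val + 1 := by omega
    simp [h1, h2]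
  · simp

theorem blockMatrix_odd {i : Fin n} {k : Fin s} (hi : i.val = 2 * k.val + 1) (j : Fin n) :
    blockMatrix n h i j = if j.val = 2 * k.val then -h k else 0 := by
  rw [blockMatrix, Finset.sum_eq_single k]
  · have : ¬ i.val = 2 * k.val := by omega
    rw [if_neg (fun e => this e.1), zero_sub]
    split_ifs <;> simp_all
  · intro l _ hl
    have h1 : ¬ i.val = 2 * l.val := by omega
    have h2 : ¬ i.val = 2 * l.val + 1 := fun e => hl (Fin.ext (by omega))
    simp [h1, h2]
  · simp

theorem blockMatrix_of_le {i : Fin n} (hi : 2 * s ≤ i.val) (j : Fin n) :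
    blockMatrix n h i j = 0 := by
  refine Finset.sum_eq_zero fun k _ => ?_
  have h1 : ¬ i.val = 2 * k.val := by omega
  have h2 : ¬ i.val = 2 * k.val + 1 := by omega
  simp [h1, h2]

theorem blockMatrix_transpose_apply (i j : Fin n) :
    blockMatrix n h j i = -blockMatrix n h i j := by
  simp only [blockMatrix, ← Finset.sum_neg_distrib, neg_sub]
  refine Finset.sum_congr rfl fun k _ => ?_
  simp only [and_comm]

theorem blockMatrix_map {S : Type*} [CommRing S] (f : R →+* S) :
    (blockMatrix n h).map f = blockMatrix n fun k => f (h k) := by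
  ext i j
  simp only [map_apply, blockMatrix, map_sum, map_sub, apply_ite f, map_zero]

theorem even_or_odd_or_le (s i : ℕ) :
    (∃ k : Fin s, i = 2 * k.val) ∨ (∃ k : Fin s, i = 2 * k.val + 1) ∨ 2 * s ≤ i := by
  by_cases hi : 2 * s ≤ i
  · exact Or.inr (Or.inr hi)
  · rcases Nat.even_or_odd' i with ⟨k, hk | hk⟩
    · exact Or.inl ⟨⟨k, by omega⟩, hk⟩
    · exact Or.inr (Or.inl ⟨⟨k, by omega⟩, hk⟩)

/-- Two block matrices coincide if their nonzero blocks do. -/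
theorem blockMatrix_congr {s' : ℕ} (h' : Fin s' → R) (hs : s ≤ s')
    (h1 : ∀ k : Fin s, h k = h' (Fin.castLE hs k))
    (h2 : ∀ k : Fin s', s ≤ k.val → 2 * k.val + 1 < n → h' k = 0) :
    blockMatrix n h = blockMatrix n h' := by
  ext i j
  rcases even_or_odd_or_le s i with ⟨k, hk⟩ | ⟨k, hk⟩ | hi
  · rw [blockMatrix_even h hk, blockMatrix_even h' (k := Fin.castLE hs k) hk, h1]
    rfl
  · rw [blockMatrix_odd h hk, blockMatrix_odd h' (k := Fin.castLE hs k) hk, h1]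
    rfl
  · rw [blockMatrix_of_le h hi]
    rcases even_or_odd_or_le s' i with ⟨k, hk⟩ | ⟨k, hk⟩ | hi'
    · rw [blockMatrix_even h' hk]
      split_ifs with hj
      · exact (h2 k (by omega) (by omega)).symm
      · rfl
    · rw [blockMatrix_odd h' hk, h2 k (by omega) (by omega)]
      simp
    · rw [blockMatrix_of_le h' hi']

theorem blockMatrix_mulVec_even (x : Fin n → R) {i j : Fin n} {k : Fin s} (hi : i.val = 2 * k.val)
    (hj : j.val = 2 * k.val + 1) : (blockMatrix n h *ᵥ x) i = h k * x j := by
  rw [mulVec, dotProduct, Finset.sum_eq_single j]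
  · rw [blockMatrix_even h hi, if_pos hj]
  · intro l _ hl
    rw [blockMatrix_even h hi, if_neg (fun e => hl (Fin.ext (by omega))), zero_mul]
  · simp

theorem blockMatrix_mulVec_odd (x : Fin n → R) {i j : Fin n} {k : Fin s}
    (hi : i.val = 2 * k.val + 1) (hj : j.val = 2 * k.val) :
    (blockMatrix n h *ᵥ x) i = -(h k * x j) := by
  rw [mulVec, dotProduct, Finset.sum_eq_single j]
  · rw [blockMatrix_odd h hi, if_pos hj, neg_mul]
  · intro l _ hl
    rw [blockMatrix_odd h hi, if_neg (fun e => hl (Fin.ext (by omega))), zero_mul]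
  · simp

theorem blockMatrix_mulVec_of_le (x : Fin n → R) {i : Fin n} (hi : 2 * s ≤ i.val) :
    (blockMatrix n h *ᵥ x) i = 0 := by
  simp [mulVec, dotProduct, blockMatrix_of_le h hi]

/-- Rescaling a block matrix by a diagonal matrix. -/
theorem diagonal_mul_blockMatrix_mul_diagonal (hs : 2 * s ≤ n) (w : Fin n → R) (h' : Fin s → R)
    (H : ∀ k : Fin s, w ⟨2 * k.val, by omega⟩ * w ⟨2 * k.val + 1, by omega⟩ * h k = h' k) :
    diagonal w * blockMatrix n h * (diagonal w)ᵀ = blockMatrix n h' := by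
  ext i j
  rw [diagonal_transpose, mul_diagonal, diagonal_mul]
  rcases even_or_odd_or_le s i with ⟨k, hk⟩ | ⟨k, hk⟩ | hi
  · rw [blockMatrix_even h hk, blockMatrix_even h' hk]
    split_ifs with hj
    · rw [← H, show i = ⟨2 * k.val, by omega⟩ from Fin.ext hk,
        show j = ⟨2 * k.val + 1, by omega⟩ from Fin.ext hj]
      ring
    · simp
  · rw [blockMatrix_odd h hk, blockMatrix_odd h' hk]
    split_ifs with hj
    · rw [← H, show i = ⟨2 * k.val + 1, by omega⟩ from Fin.ext hk,
        show j = ⟨2 * k.val, by omega⟩ from Fin.ext hj]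
      ring
    · simp
  · rw [blockMatrix_of_le h hi, blockMatrix_of_le h' hi]
    simp

/-- The entries after prepending one block, as needed for the induction that splits off a hyperbolic
plane. -/
theorem blockMatrix_cons_zero_zero (a : R) :
    blockMatrix (n + 2) (Fin.cons a h) 0 0 = 0 := by
  rw [blockMatrix_even (k := 0) _ (by simp)]
  simp

theorem blockMatrix_cons_zero_one (a : R) :
    blockMatrix (n + 2) (Fin.cons a h) 0 1 = a := by
  rw [blockMatrix_even (k := 0) _ (by simp)]
  simp

theorem blockMatrix_cons_one_one (a : R) :
    blockMatrix (n + 2) (Fin.cons a h) 1 1 = 0 := by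
  rw [blockMatrix_odd (k := 0) _ (by simp)]
  simp

theorem blockMatrix_cons_zero_succ (a : R) (j : Fin n) :
    blockMatrix (n + 2) (Fin.cons a h) 0 j.succ.succ = 0 := by
  rw [blockMatrix_even (k := 0) _ (by simp)]
  simp

theorem blockMatrix_cons_one_succ (a : R) (j : Fin n) :
    blockMatrix (n + 2) (Fin.cons a h) 1 j.succ.succ = 0 := by
  rw [blockMatrix_odd (k := 0) _ (by simp)]
  simp

theorem blockMatrix_cons_succ_succ (a : R) (i j : Fin n) :
    blockMatrix (n + 2) (Fin.cons a h) i.succ.succ j.succ.succ = blockMatrix n h i j := by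
  simp only [blockMatrix]
  rw [Fin.sum_univ_succ]
  simp [mul_add]

end Block

/-! ### Alternating forms over `ℤ` -/

section Alternating

open Module

/-- Every integral alternating form has a basis in which its Gram matrix is a block matrix
`N(h₁,…,h_s)` with `h₁ ∣ h₂ ∣ ⋯ ∣ h_s`. -/
theorem exists_basis_alternating (n : ℕ) {V : Type*} [AddCommGroup V] [Module.Free ℤ V]
    [Module.Finite ℤ V] (hn : finrank ℤ V = n) (B : V →ₗ[ℤ] V →ₗ[ℤ] ℤ) (hB : ∀ v, B v v = 0) :
    ∃ (b : Basis (Fin n) ℤ V) (s : ℕ) (h : Fin s → ℤ), 2 * s ≤ n ∧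
      (∀ i j, i ≤ j → h i ∣ h j) ∧ (∀ c : ℤ, (∀ v w, c ∣ B v w) → ∀ i, c ∣ h i) ∧
      ∀ i j, B (b i) (b j) = blockMatrix n h i j := by
  induction n using Nat.strong_induction_on generalizing V with
  | _ n ih =>
  by_cases h0 : ∀ v w, B v w = 0
  · exact ⟨finBasisOfFinrankEq ℤ V hn, 0, Fin.elim0, by simp, fun i => i.elim0,
      fun _ _ i => i.elim0, fun i j => by simp [h0, blockMatrix]⟩
  push Not at h0
  have hswap : ∀ v w, B v w = -B w v := fun v w => by
    have := hB (v + w)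
    simp only [map_add, LinearMap.add_apply, hB, add_zero, zero_add] at this
    linarith
  -- A pair x, y with |B x y| minimal among the non-zero values spans the first block.
  let P : ℕ → Prop := fun k => ∃ v w, B v w ≠ 0 ∧ (B v w).natAbs = k
  have hP : ∃ k, P k := by
    obtain ⟨v, w, hvw⟩ := h0
    exact ⟨_, v, w, hvw, rfl⟩
  classical
  obtain ⟨x, y, hne, hxy⟩ := Nat.find_spec hP
  have hmin : ∀ v w, (B v w).natAbs < (B x y).natAbs → B v w = 0 := by
    intro v w hvw
    by_contra hcon
    exact Nat.find_min hP (hxy ▸ hvw) ⟨v, w, hcon, rfl⟩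
  -- A remainder modulo B x y that is itself a value of B vanishes by minimality. Subtracting
  -- multiples of x or y from an argument realises the remainders used below.
  have hmod : ∀ v w k, B v w = k % B x y → k % B x y = 0 := by
    intro v w k hk
    rw [← hk]
    apply hmin
    rw [hk]
    have h1 := Int.emod_nonneg k hne
    have h2 := Int.emod_lt_abs k hne
    zify
    rwa [abs_of_nonneg h1]
  have hx : ∀ v, B x y ∣ B x v := fun v => by
    apply Int.dvd_of_emod_eq_zero
    refine hmod x (v - (B x v / B x y) • y) _ ?_
    rw [map_sub, map_smul, smul_eq_mul, Int.emod_def, mul_comm]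
  have hy : ∀ v, B x y ∣ B v y := fun v => by
    apply Int.dvd_of_emod_eq_zero
    refine hmod (v - (B v y / B x y) • x) y _ ?_
    rw [map_sub, map_smul, LinearMap.sub_apply, LinearMap.smul_apply, smul_eq_mul, Int.emod_def,
      mul_comm]
  have hW : ∀ v w, B v y = 0 → B x w = 0 → B x y ∣ B v w := fun v w hv hw => by
    apply Int.dvd_of_emod_eq_zero
    refine hmod (x + v) (w - (B v w / B x y) • y) _ ?_
    simp only [map_sub, map_smul, map_add, LinearMap.add_apply, hv, hw, smul_eq_mul, Int.emod_def,
      add_zero, zero_add]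
    ring
  let O : Submodule ℤ V := LinearMap.ker (B.flip y)
  let W : Submodule ℤ V := LinearMap.ker (B x) ⊓ O
  have hWmem : ∀ w ∈ W, B x w = 0 ∧ B w y = 0 := fun w hw => hw
  obtain ⟨k, hk⟩ : ∃ k, finrank ℤ W = k := ⟨_, rfl⟩
  have hWO : W ≤ O := inf_le_right
  have hyO : y ∈ O := hB y
  -- V = ℤx ⊕ ℤy ⊕ W with W orthogonal to x and y: the projections are integral because B x y
  -- divides every B x v and every B v y.
  let mk := fun b : Basis (Fin k) ℤ W =>
    Basis.mkFinCons x (Basis.mkFinConsOfLE y hyO b hWO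
      (fun c w hw e => by
        have := congrArg (B x) e
        rw [map_add, map_smul, (hWmem w hw).1, add_zero, map_zero, smul_eq_mul] at this
        exact (mul_eq_zero.mp this).resolve_right hne)
      (fun z hz => by
        obtain ⟨c, hc⟩ := hx z
        refine ⟨-c, ?_, O.add_mem hz (O.smul_mem _ hyO)⟩
        change B x (z + -c • y) = 0
        rw [map_add, map_smul, hc, smul_eq_mul]
        ring))
      (fun c w hw e => by
        have := congrArg (fun v => B v y) e
        simp only [map_add, map_smul, LinearMap.add_apply, LinearMap.smul_apply,
          show B w y = 0 from hw, add_zero, map_zero, smul_eq_mul, LinearMap.zero_apply] at this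
        exact (mul_eq_zero.mp this).resolve_right hne)
      (fun z => by
        obtain ⟨c, hc⟩ := hy z
        refine ⟨-c, ?_⟩
        change B (z + -c • x) y = 0
        rw [map_add, map_smul, LinearMap.add_apply, LinearMap.smul_apply, hc, smul_eq_mul]
        ring)
  have hmk : ∀ b, (mk b : Fin (k + 2) → V) = Fin.cons x (Fin.cons y fun i => (b i : V)) := by
    intro b
    simp only [mk, Basis.coe_mkFinCons, Basis.coe_mkFinConsOfLE]
    congr 1
    ext i
    refine Fin.cases ?_ (fun i => ?_) i <;> simp
  obtain rfl : n = k + 2 := by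
    rw [← hn, finrank_eq_card_basis (mk (finBasisOfFinrankEq ℤ W hk)), Fintype.card_fin]
  obtain ⟨b, s, h, hs, hdvd, hgcd, hb⟩ := ih k (by omega) hk (B.domRestrict₁₂ W W)
    (fun v => hB v)
  refine ⟨mk b, s + 1, Fin.cons (B x y) h, by omega, ?_, ?_, ?_⟩
  -- This is what the clause about common divisors of all values of B is carried for: applied to W,
  -- it shows that B x y divides the remaining blocks.
  · have h1 : ∀ i, B x y ∣ h i := hgcd _ fun v w => hW v w (hWmem v v.2).2 (hWmem w w.2).1
    intro i j
    refine Fin.cases ?_ (fun i => ?_) i <;> refine Fin.cases ?_ (fun j => ?_) j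
    · simp
    · simp [h1]
    · simp
    · simpa using hdvd i j
  · intro c hc i
    refine Fin.cases ?_ (fun i => ?_) i
    · simp [hc]
    · simpa using hgcd c (fun v w => hc v w) i
  · have key : ∀ i j, i ≤ j →
        B (mk b i) (mk b j) = blockMatrix (k + 2) (Fin.cons (B x y) h) i j := by
      intro i j
      rw [hmk]
      refine Fin.cases ?_ (fun i => ?_) i
      · refine Fin.cases ?_ (fun j => ?_) j
        · simp [blockMatrix_cons_zero_zero, hB]
        · refine Fin.cases ?_ (fun j => ?_) j
          · simp [blockMatrix_cons_zero_one]
          · simp [blockMatrix_cons_zero_succ, (hWmem _ (b j).2).1]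
      · refine Fin.cases ?_ (fun i => ?_) i
        · refine Fin.cases ?_ (fun j => ?_) j
          · simp
          · refine Fin.cases ?_ (fun j => ?_) j
            · simp [blockMatrix_cons_one_one, hB]
            · simp [blockMatrix_cons_one_succ, hswap y, (hWmem _ (b j).2).2]
        · refine Fin.cases ?_ (fun j => ?_) j
          · simp
          · refine Fin.cases ?_ (fun j => ?_) j
            · simp [Fin.le_def]
            · intro _
              rw [blockMatrix_cons_succ_succ, ← hb i j]
              rfl
    intro i j
    rcases le_total i j with hij | hij
    · exact key i j hij
    · rw [hswap, key j i hij, blockMatrix_transpose_apply, neg_neg]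

end Alternating

/-! ### Congruence of alternating matrices over `ℤ/m` -/

section Congruence

open Matrix

variable {R : Type*} [CommRing R] {n : ℕ}

/-- The congruence action `N ↦ g N gᵀ`. -/
def congruence (g : GL (Fin n) R) (N : Matrix (Fin n) (Fin n) R) : Matrix (Fin n) (Fin n) R :=
  (g : Matrix (Fin n) (Fin n) R) * N * (g : Matrix (Fin n) (Fin n) R)ᵀ

theorem congruence_mul (g g' : GL (Fin n) R) (N : Matrix (Fin n) (Fin n) R) :
    congruence (g * g') N = congruence g (congruence g' N) := by
  simp [congruence, Matrix.mul_assoc]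

theorem congruence_one (N : Matrix (Fin n) (Fin n) R) : congruence 1 N = N := by
  simp [congruence]

theorem congruence_inv {g : GL (Fin n) R} {N N' : Matrix (Fin n) (Fin n) R}
    (h : congruence g N = N') : congruence g⁻¹ N' = N := by
  rw [← h, ← congruence_mul, inv_mul_cancel, congruence_one]

theorem congruence_smul (g : GL (Fin n) R) (a : R) (N : Matrix (Fin n) (Fin n) R) :
    congruence g (a • N) = a • congruence g N := by
  simp [congruence]

theorem mem_detGroup_iff {s : ℕ} {h : Fin s → R} {e : Rˣ} :
    e ∈ detGroup n h ↔ ∃ g : GL (Fin n) R, congruence g (blockMatrix n h) = blockMatrix n h ∧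
      GeneralLinearGroup.det g = e := Iff.rfl

/-- The diagonal entries `(1, …, 1, z)`. -/
def lastScale (n : ℕ) (z : Rˣ) : Fin n → Rˣ := fun i => if i.val + 1 = n then z else 1

theorem prod_lastScale (hn : n ≠ 0) (z : Rˣ) : ∏ i, lastScale n z i = z := by
  obtain ⟨k, rfl⟩ := Nat.exists_eq_succ_of_ne_zero hn
  rw [Finset.prod_eq_single (Fin.last k)]
  · simp [lastScale]
  · intro i _ hi
    exact if_neg fun e => hi (Fin.ext (by simpa using e))
  · simp

/-- If 2s < n, the last coordinate lies in the zero block, so scaling it changes nothing and z is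
arbitrary. -/
theorem congruence_lastScale {m : ℕ} (d : NormalFormData n m) (z : (ZMod m)ˣ)
    (hz : 2 * d.s = n → d.z = z) :
    congruence (diagGL _ (lastScale n z)) (blockMatrix n d.h) = blockMatrix n d.exponent := by
  have h2 := d.two_mul_le
  rw [congruence, coe_diagGL]
  refine diagonal_mul_blockMatrix_mul_diagonal _ h2 _ _ fun k => ?_
  rw [NormalFormData.exponent]
  have h1 : lastScale n z ⟨2 * k.val, by omega⟩ = 1 := if_neg (by simp; omega)
  rw [h1, lastScale]
  by_cases hk : k.val + 1 = d.s
  · by_cases hs : 2 * d.s = n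
    · rw [if_pos (by simp; omega), if_pos hk, hz hs]
      simp
    · rw [if_neg (by simp; omega), if_pos hk, d.z_eq_one (by omega)]
      simp
  · rw [if_neg (by simp; omega), if_neg hk]
    simp

/-- Alternating matrices over `ℤ/m` are congruent, under `GL_n(ℤ)`, to block matrices. -/
theorem exists_congruence_blockMatrix_intCast {m : ℕ} (M : Matrix (Fin n) (Fin n) (ZMod m))
    (hdiag : ∀ i, M i i = 0) (hskew : ∀ i j, M j i = -M i j) :
    ∃ (P : GL (Fin n) ℤ) (s : ℕ) (h : Fin s → ℤ), 2 * s ≤ n ∧ (∀ i j, i ≤ j → h i ∣ h j) ∧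
      congruence (reduceGL m P) M = blockMatrix n fun k => ((h k : ℤ) : ZMod m) := by
  choose r hr using ZMod.intCast_surjective (n := m)
  -- Lifting only the entries above the diagonal and antisymmetrising makes L alternating over ℤ,
  -- not merely modulo m.
  let L : Matrix (Fin n) (Fin n) ℤ := .of fun i j =>
    if i < j then r (M i j) else if j < i then -r (M j i) else 0
  have hL : L.map (Int.castRingHom (ZMod m)) = M := by
    ext i j
    rcases lt_trichotomy i j with h | rfl | h
    · simp [L, h, hr]
    · simp [L, hdiag]
    · simp [L, h, h.not_gt, hr, hskew i j]
  have hLskew : Lᵀ = -L := by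
    ext i j
    rcases lt_trichotomy i j with h | rfl | h
    · simp [L, h, h.not_gt]
    · simp [L]
    · simp [L, h, h.not_gt]
  have halt : ∀ v : Fin n → ℤ, toLinearMap₂' ℤ L v v = 0 := fun v => by
    have h1 : toLinearMap₂' ℤ L v v = -toLinearMap₂' ℤ L v v := by
      simp only [toLinearMap₂'_apply']
      conv_lhs => rw [dotProduct_mulVec, ← mulVec_transpose, hLskew, neg_mulVec, neg_dotProduct,
        dotProduct_comm]
    linarith
  obtain ⟨b, s, h, hs, hdvd, -, hb⟩ := exists_basis_alternating n (by simp) (toLinearMap₂' ℤ L) halt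
  let e := Pi.basisFun ℤ (Fin n)
  refine ⟨⟨(e.toMatrix b)ᵀ, (b.toMatrix e)ᵀ, ?_, ?_⟩, s, h, hs, hdvd, ?_⟩
  · rw [← transpose_mul, Module.Basis.toMatrix_mul_toMatrix_flip, transpose_one]
  · rw [← transpose_mul, Module.Basis.toMatrix_mul_toMatrix_flip, transpose_one]
  · have hZ : (e.toMatrix b)ᵀ * L * (e.toMatrix b)ᵀᵀ = blockMatrix n h := by
      ext i j
      rw [← hb i j, toLinearMap₂'_apply', dotProduct_mulVec]
      rfl
    have := congrArg (Int.castRingHom (ZMod m)).mapMatrix hZ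
    rw [map_mul, map_mul, RingHom.mapMatrix_apply, RingHom.mapMatrix_apply, RingHom.mapMatrix_apply,
      RingHom.mapMatrix_apply, hL, blockMatrix_map] at this
    exact this

theorem dvd_of_natCast_dvd {m a b : ℕ} (ha : a ∣ m) (h : (a : ZMod m) ∣ (b : ZMod m)) : a ∣ b := by
  obtain ⟨c, hc⟩ := h
  have := congrArg (ZMod.castHom ha (ZMod a)) hc
  rw [map_mul, map_natCast, map_natCast, ZMod.natCast_self, zero_mul] at this
  exact (ZMod.natCast_eq_zero_iff b a).mp this

/-- Existence of the normal form of an alternating matrix over `ℤ/m`. -/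
theorem exists_congruence_exponent {m : ℕ} (hm : m ≠ 0) (M : Matrix (Fin n) (Fin n) (ZMod m))
    (hdiag : ∀ i, M i i = 0) (hskew : ∀ i j, M j i = -M i j)
    (hgen : ∀ a : ZMod m, a • M = 0 → a = 0) :
    ∃ (P : GL (Fin n) ℤ) (d : NormalFormData n m),
      congruence (reduceGL m P) M = blockMatrix n d.exponent := by
  classical
  obtain ⟨P, s₀, h, hs₀, hdvd, hP⟩ := exists_congruence_blockMatrix_intCast M hdiag hskew
  -- The first block that vanishes modulo m, or s₀ if there is none. By divisibility all later
  -- blocks vanish too and can be dropped.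
  have hex : ∃ k, k = s₀ ∨ ∃ hk : k < s₀, ((h ⟨k, hk⟩ : ℤ) : ZMod m) = 0 := ⟨s₀, Or.inl rfl⟩
  set s := Nat.find hex with hs
  have hss : s ≤ s₀ := Nat.find_le (Or.inl rfl)
  have hne : ∀ k : Fin s, ((h (Fin.castLE hss k) : ℤ) : ZMod m) ≠ 0 := fun k e =>
    Nat.find_min hex k.isLt (Or.inr ⟨by omega, e⟩)
  have hzero : ∀ k : Fin s₀, s ≤ k.val → ((h k : ℤ) : ZMod m) = 0 := fun k hk => by
    rcases Nat.find_spec hex with h1 | ⟨h1, h2⟩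
    · omega
    · obtain ⟨c, hc⟩ := hdvd ⟨s, h1⟩ k hk
      rw [hc, Int.cast_mul, h2, zero_mul]
  choose D hDm v hv hD using fun k : Fin s =>
    ZMod.eq_unit_mul_divisor ((h (Fin.castLE hss k) : ℤ) : ZMod m)
  choose w hw using hv
  have hN : congruence (reduceGL m P) M = blockMatrix n fun k : Fin s => (w k : ZMod m) * D k := by
    rw [hP]
    refine (blockMatrix_congr _ _ hss (fun k => ?_) fun k hk _ => hzero k hk).symm
    rw [hw, hD]
  -- The first coordinate of each block absorbs the unit `w k`, leaving the divisor `D k`.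
  let ω : Fin n → (ZMod m)ˣ := fun i =>
    if hi : i.val / 2 < s ∧ i.val % 2 = 0 then (w ⟨i.val / 2, hi.1⟩)⁻¹ else 1
  let d : NormalFormData n m :=
    { s := s
      two_mul_le := by omega
      h := fun k => (D k : ZMod m)
      h_first := by
        intro k hk
        -- Here m = D k * c. The first block divides all the others, so c kills the whole matrix;
        -- then `hgen` gives m ∣ c, which forces D k = 1.
        obtain ⟨c, hc⟩ := hDm k
        have hc0 : ((c : ℕ) : ZMod m) = 0 := by
          refine hgen _ ?_
          have : congruence (reduceGL m P) ((c : ZMod m) • M) = 0 := by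
            rw [congruence_smul, hP]
            ext i j
            have hall : ∀ l : Fin s₀, (c : ZMod m) * ((h l : ℤ) : ZMod m) = 0 := fun l => by
              obtain ⟨x, hx⟩ := hdvd (Fin.castLE hss k) l (by simp [Fin.le_def, hk])
              rw [hx, Int.cast_mul, hD k, mul_comm (v k), ← mul_assoc, ← mul_assoc,
                ← Nat.cast_mul, mul_comm c, ← hc, ZMod.natCast_self]
              simp
            rw [Matrix.smul_apply, blockMatrix, smul_eq_mul, Finset.mul_sum]
            refine Finset.sum_eq_zero fun l _ => ?_
            rw [mul_sub, mul_ite, mul_ite, hall]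
            simp
          rw [← congruence_inv this, congruence]
          simp
        obtain ⟨x, hx⟩ := (ZMod.natCast_eq_zero_iff c m).mp hc0
        have : c ≠ 0 := by rintro rfl; simp at hc; omega
        have hDx : D k * x = 1 := by
          apply Nat.eq_of_mul_eq_mul_left (Nat.pos_of_ne_zero this)
          rw [mul_one, ← mul_assoc, mul_comm c, ← hc, ← hx]
        rw [Nat.eq_one_of_mul_eq_one_right hDx, Nat.cast_one]
      h_mem := fun k => ⟨D k, hDm k, rfl⟩
      h_ne_zero := fun k e => hne k (by rw [hD, e, mul_zero])
      h_dvd := by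
        intro i j hij
        have h1 : ((h (Fin.castLE hss i) : ℤ) : ZMod m) ∣ ((h (Fin.castLE hss j) : ℤ) : ZMod m) :=
          map_dvd (Int.castRingHom (ZMod m)) (hdvd _ _ hij)
        rw [hD, hD, ← hw, ← hw] at h1
        simpa using h1
      -- Scaling the last coordinate by (∏ ω)⁻¹ brings the total determinant to 1, so that the
      -- scaling lifts to ℤ. This costs a unit in the last block only if 2s = n.
      z := if 2 * s < n then 1 else (∏ i, ω i)⁻¹
      z_eq_one := fun hlt => if_pos hlt }
  have h1 : congruence (diagGL _ ω) (blockMatrix n fun k : Fin s => (w k : ZMod m) * D k) =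
      blockMatrix n d.h := by
    rw [congruence, coe_diagGL]
    refine diagonal_mul_blockMatrix_mul_diagonal _ d.two_mul_le _ _ fun k => ?_
    have hk : k.val < s := k.isLt
    have e1 : ω ⟨2 * k.val, by omega⟩ = (w k)⁻¹ := by
      have : (2 * k.val) / 2 < s ∧ (2 * k.val) % 2 = 0 := by omega
      simp only [ω, dif_pos this]
      congr 2
      exact Fin.ext (by simp)
    have e2 : ω ⟨2 * k.val + 1, by omega⟩ = 1 := dif_neg (by simp)
    rw [e1, e2]
    simp [d]
  have h2 := congruence_lastScale d (∏ i, ω i)⁻¹ (fun e => if_neg (by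
    change 2 * s = n at e
    omega))
  have hdet : GeneralLinearGroup.det (diagGL _ (lastScale n (∏ i, ω i)⁻¹) * diagGL _ ω) = 1 := by
    rw [map_mul, det_diagGL, det_diagGL]
    rcases eq_or_ne n 0 with rfl | hn
    · simp
    · rw [prod_lastScale hn, inv_mul_cancel]
  obtain ⟨Q, hQ⟩ := mem_range_reduceGL m _ (Or.inl hdet)
  refine ⟨Q * P, d, ?_⟩
  rw [map_mul, congruence_mul, hN, hQ, congruence_mul, h1, h2]

/-! ### Uniqueness of the normal form -/

/-- The sequence `h₁, h₁, h₂, h₂, …, h_s, h_s, 0, …, 0`. -/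
def doubled (n : ℕ) {s : ℕ} (h : Fin s → R) : Fin n → R := fun i =>
  if hi : i.val / 2 < s then h ⟨i.val / 2, hi⟩ else 0

theorem doubled_of_lt {s : ℕ} (h : Fin s → R) {i : Fin n} {k : Fin s} (hi : i.val / 2 = k.val) :
    doubled n h i = h k := by
  rw [doubled, dif_pos (hi ▸ k.isLt)]
  congr 1
  exact Fin.ext hi

theorem doubled_of_le {s : ℕ} (h : Fin s → R) {i : Fin n} (hi : s ≤ i.val / 2) :
    doubled n h i = 0 :=
  dif_neg (by omega)

/-- Up to sign, N swaps the two coordinates of a block and multiplies them by the same h k, so its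
kernel is described coordinate by coordinate. -/
theorem smul_blockMatrix_mulVec_eq_zero_iff {s : ℕ} (hs : 2 * s ≤ n) (h : Fin s → R) (a : R)
    (x : Fin n → R) :
    (a • blockMatrix n h) *ᵥ x = 0 ↔ ∀ i, a * doubled n h i * x i = 0 := by
  rw [smul_mulVec]
  constructor
  · intro H i
    rcases even_or_odd_or_le s i with ⟨k, hk⟩ | ⟨k, hk⟩ | hi
    · have := congrFun H ⟨2 * k.val + 1, by omega⟩
      rw [Pi.smul_apply, blockMatrix_mulVec_odd h x rfl hk, smul_eq_mul] at this
      rw [doubled_of_lt h (k := k) (by omega), mul_assoc]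
      simpa using this
    · have := congrFun H ⟨2 * k.val, by omega⟩
      rw [Pi.smul_apply, blockMatrix_mulVec_even h x rfl hk, smul_eq_mul] at this
      rw [doubled_of_lt h (k := k) (by omega), mul_assoc]
      exact this
    · rw [doubled_of_le h (by omega)]
      simp
  · intro H
    ext i
    rw [Pi.smul_apply, smul_eq_mul, Pi.zero_apply]
    rcases even_or_odd_or_le s i with ⟨k, hk⟩ | ⟨k, hk⟩ | hi
    · have := H ⟨2 * k.val + 1, by omega⟩
      rw [doubled_of_lt h (k := k) (by simp; omega)] at this
      rw [blockMatrix_mulVec_even h x hk (j := ⟨2 * k.val + 1, by omega⟩) rfl, ← mul_assoc]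
      exact this
    · have := H ⟨2 * k.val, by omega⟩
      rw [doubled_of_lt h (k := k) (by simp)] at this
      rw [blockMatrix_mulVec_odd h x hk (j := ⟨2 * k.val, by omega⟩) rfl,
        mul_neg, ← mul_assoc, this, neg_zero]
    · rw [blockMatrix_mulVec_of_le h x hi, mul_zero]

theorem card_ker_smul_blockMatrix {s : ℕ} (hs : 2 * s ≤ n) (h : Fin s → R) (a : R) :
    Nat.card {x : Fin n → R // (a • blockMatrix n h) *ᵥ x = 0} =
      ∏ i, Nat.card {y : R // a * doubled n h i * y = 0} := by
  rw [← Nat.card_pi]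
  exact Nat.card_congr ((Equiv.subtypeEquivRight
    fun x => smul_blockMatrix_mulVec_eq_zero_iff hs h a x).trans
      (Equiv.subtypePiEquivPi (p := fun i y => a * doubled n h i * y = 0)))

/-- Kernel sizes are congruence invariants: gᵀ permutes Rⁿ and g is injective. Applied to all
multiples of a block matrix, this gives enough invariants to recover h. -/
theorem card_ker_congruence (g : GL (Fin n) R) (N : Matrix (Fin n) (Fin n) R) :
    Nat.card {x : Fin n → R // (congruence g N) *ᵥ x = 0} =
      Nat.card {x : Fin n → R // N *ᵥ x = 0} := by
  have hinj : ∀ y, (g : Matrix (Fin n) (Fin n) R) *ᵥ y = 0 ↔ y = 0 := fun y => by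
    refine ⟨fun hy => ?_, fun hy => by rw [hy, mulVec_zero]⟩
    have := congrArg (fun v => ((g⁻¹ : GL (Fin n) R) : Matrix (Fin n) (Fin n) R) *ᵥ v) hy
    simpa [mulVec_mulVec, ← Units.val_mul] using this
  have ht : (g : Matrix (Fin n) (Fin n) R)ᵀ *
      ((g⁻¹ : GL (Fin n) R) : Matrix (Fin n) (Fin n) R)ᵀ = 1 := by
    rw [← transpose_mul, ← Units.val_mul, inv_mul_cancel, Units.val_one, transpose_one]
  have ht' : ((g⁻¹ : GL (Fin n) R) : Matrix (Fin n) (Fin n) R)ᵀ *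
      (g : Matrix (Fin n) (Fin n) R)ᵀ = 1 := by
    rw [← transpose_mul, ← Units.val_mul, mul_inv_cancel, Units.val_one, transpose_one]
  let e : (Fin n → R) ≃ (Fin n → R) :=
    { toFun := fun x => (g : Matrix (Fin n) (Fin n) R)ᵀ *ᵥ x
      invFun := fun x => ((g⁻¹ : GL (Fin n) R) : Matrix (Fin n) (Fin n) R)ᵀ *ᵥ x
      left_inv := fun x => by simp only; rw [mulVec_mulVec, ht', one_mulVec]
      right_inv := fun x => by simp only; rw [mulVec_mulVec, ht, one_mulVec] }
  refine Nat.card_congr (e.subtypeEquiv fun x => ?_)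
  rw [congruence, ← mulVec_mulVec, ← mulVec_mulVec, hinj]
  rfl

/-- A divisibility chain in a finite ring is determined, up to annihilators, by the cardinalities
of the kernels of its multiples. -/
theorem annihilator_eq_of_prod_card_eq [Finite R] (t t' : Fin n → R)
    (ht : ∀ i j, i ≤ j → t i ∣ t j) (ht' : ∀ i j, i ≤ j → t' i ∣ t' j)
    (H : ∀ a, ∏ i, Nat.card {y : R // a * t i * y = 0} =
      ∏ i, Nat.card {y : R // a * t' i * y = 0}) (i : Fin n) (a : R) :
    a * t i = 0 ↔ a * t' i = 0 := by
  have key : ∀ (t t' : Fin n → R), (∀ i j, i ≤ j → t i ∣ t j) →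
      (∀ a, ∏ i, Nat.card {y : R // a * t i * y = 0} =
        ∏ i, Nat.card {y : R // a * t' i * y = 0}) →
      ∀ i, (∀ j < i, ∀ a, a * t j = 0 ↔ a * t' j = 0) → ∀ a, a * t i = 0 → a * t' i = 0 := by
    intro t t' ht H i hlt a ha
    -- Since a kills t i, it kills t j for all j ≥ i, so those kernels for t are all of R; for j < i
    -- the kernels agree by hypothesis. Equal products then force equality at i, so 1 is in the
    -- kernel of a * t' i.
    have hle : ∀ j, Nat.card {y : R // a * t' j * y = 0} ≤ Nat.card {y : R // a * t j * y = 0} := by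
      intro j
      rcases lt_or_ge j i with hj | hj
      · refine (Nat.card_congr (Equiv.subtypeEquivRight fun y => ?_)).le
        rw [mul_right_comm, ← hlt j hj, mul_right_comm]
      · refine Nat.card_mono (Set.toFinite _) fun y _ => ?_
        obtain ⟨c, hc⟩ := ht i j hj
        change a * t j * y = 0
        rw [hc, ← mul_assoc, ha, zero_mul, zero_mul]
    have heq : Nat.card {y : R // a * t' i * y = 0} = Nat.card {y : R // a * t i * y = 0} := by
      by_contra hne
      refine (Finset.prod_lt_prod (s := Finset.univ) (fun j _ => ?_) (fun j _ => hle j)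
        ⟨i, Finset.mem_univ i, (hle i).lt_of_ne hne⟩).ne (H a).symm
      have : Nonempty {y : R // a * t' j * y = 0} := ⟨0, mul_zero _⟩
      exact Nat.card_pos
    have hall : {y : R | a * t' i * y = 0} = Set.univ := by
      refine Set.eq_of_subset_of_ncard_le (Set.subset_univ _) ?_
      change Nat.card _ ≤ Nat.card {y : R // a * t' i * y = 0}
      rw [heq]
      refine Nat.card_mono (Set.toFinite _) fun y _ => ?_
      change a * t i * y = 0
      rw [ha, zero_mul]
    have h1 : (1 : R) ∈ {y : R | a * t' i * y = 0} := hall ▸ Set.mem_univ _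
    simpa using h1
  induction i using WellFoundedLT.induction generalizing a with
  | ind i ih =>
    exact ⟨key t t' ht H i (fun j hj a => ih j hj a) a,
      key t' t ht' (fun a => (H a).symm) i (fun j hj a => (ih j hj a).symm) a⟩

theorem doubled_dvd {s : ℕ} {h : Fin s → R} (hdvd : ∀ i j, i ≤ j → h i ∣ h j) {i j : Fin n}
    (hij : i ≤ j) : doubled n h i ∣ doubled n h j := by
  have : i.val / 2 ≤ j.val / 2 := Nat.div_le_div_right hij
  by_cases hj : j.val / 2 < s
  · rw [doubled, doubled, dif_pos hj, dif_pos (this.trans_lt hj)]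
    exact hdvd _ _ this
  · rw [doubled_of_le h (i := j) (by omega)]
    exact dvd_zero _

/-- Elements of `cosetReps` are determined by their annihilators. -/
theorem eq_of_mem_cosetReps {m : ℕ} [NeZero m] {x y : ZMod m}
    (hx : x ∈ cosetReps m) (hy : y ∈ cosetReps m)
    (h : ∀ a, a * x = 0 ↔ a * y = 0) : x = y := by
  obtain ⟨d, hd, rfl⟩ := hx
  obtain ⟨e, he, rfl⟩ := hy
  have key : ∀ d e : ℕ, d ∣ m → (∀ a : ZMod m, a * d = 0 → a * e = 0) → d ∣ e := by
    rintro d e ⟨c, hc⟩ h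
    have h1 := h c (by rw [← Nat.cast_mul, mul_comm, ← hc, ZMod.natCast_self])
    rw [← Nat.cast_mul, ZMod.natCast_eq_zero_iff, hc, mul_comm c] at h1
    refine Nat.dvd_of_mul_dvd_mul_right (Nat.pos_of_ne_zero ?_) h1
    rintro rfl
    exact NeZero.ne m (by simpa using hc)
  rw [Nat.dvd_antisymm (key d e hd (fun a => (h a).1)) (key e d he fun a => (h a).2)]

/-- Kernel sizes give the annihilators of all entries of the doubled sequences. The vanishing
pattern yields s, and a divisor of m is determined by its annihilator in ℤ/m. -/
theorem NormalFormData.eq_of_congruence {m : ℕ} [NeZero m] (d d' : NormalFormData n m)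
    (g : GL (Fin n) (ZMod m)) (hg : congruence g (blockMatrix n d.h) = blockMatrix n d'.h) :
    ∃ hs : d.s = d'.s, ∀ i, d.h i = d'.h (Fin.cast hs i) := by
  have hann := annihilator_eq_of_prod_card_eq (doubled n d.h) (doubled n d'.h)
    (fun i j => doubled_dvd d.h_dvd) (fun i j => doubled_dvd d'.h_dvd) (fun a => by
      rw [← card_ker_smul_blockMatrix d.two_mul_le, ← card_ker_smul_blockMatrix d'.two_mul_le,
        ← hg, ← congruence_smul, card_ker_congruence])
  have hzero : ∀ i, doubled n d.h i = 0 ↔ doubled n d'.h i = 0 := fun i => by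
    simpa using hann i 1
  have key : ∀ d d' : NormalFormData n m,
      (∀ i, doubled n d.h i = 0 ↔ doubled n d'.h i = 0) → d.s ≤ d'.s := by
    intro d d' hz
    by_contra hlt
    push Not at hlt
    have h2 := d.two_mul_le
    refine d.h_ne_zero ⟨d'.s, hlt⟩ ?_
    rw [← doubled_of_lt (n := n) d.h (i := ⟨2 * d'.s, by omega⟩) (k := ⟨d'.s, hlt⟩) (by simp), hz]
    exact doubled_of_le _ (by simp)
  have hs : d.s = d'.s := le_antisymm (key d d' hzero) (key d' d fun i => (hzero i).symm)
  refine ⟨hs, fun i => eq_of_mem_cosetReps (d.h_mem i) (d'.h_mem _) fun a => ?_⟩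
  have h2 := d.two_mul_le
  have := hann ⟨2 * i.val, by omega⟩ a
  rwa [doubled_of_lt d.h (k := i) (by simp),
    doubled_of_lt d'.h (k := Fin.cast hs i) (by simp)] at this

/-! ### Congruence under `GL_n(ℤ)` -/

/-- Scaling the last coordinate by z and z' turns a congruence of exponent matrices into one of the
matrices of h, and multiplies determinants by z/z'. The condition det G = ±1 then becomes the
condition on z'. For n = 0 no coordinate can carry z, so the units of ℤ/m have to be trivial. -/
theorem NormalFormData.exists_congruence_iff_related {m : ℕ} [NeZero m]
    (hnm : n = 0 → m = 1) (d d' : NormalFormData n m) :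
    (∃ G : GL (Fin n) ℤ, congruence (reduceGL m G) (blockMatrix n d.exponent) =
      blockMatrix n d'.exponent) ↔ d.Related d' := by
  have hd := congruence_lastScale d d.z fun _ => rfl
  have hd' := congruence_lastScale d' d'.z fun _ => rfl
  have hstab : ∀ (G : GL (Fin n) (ZMod m)),
      (congruence G (blockMatrix n d.exponent) = blockMatrix n d'.exponent ↔
      congruence ((diagGL _ (lastScale n d'.z))⁻¹ * G * diagGL _ (lastScale n d.z))
        (blockMatrix n d.h) = blockMatrix n d'.h) := by
    intro G
    rw [congruence_mul, congruence_mul, hd]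
    constructor
    · intro h
      rw [h]
      exact congruence_inv hd'
    · intro h
      have := congruence_inv h
      rw [inv_inv, hd'] at this
      exact this.symm
  constructor
  · rintro ⟨G, hG⟩
    rw [hstab] at hG
    obtain ⟨hs, hh⟩ := eq_of_congruence d d' _ hG
    have hN : blockMatrix n d'.h = blockMatrix n d.h :=
      (blockMatrix_congr d.h d'.h hs.le hh fun k hk => by omega).symm
    rw [hN] at hG
    refine ⟨hs, hh, ?_⟩
    rcases eq_or_ne n 0 with rfl | hn
    · obtain rfl := hnm rfl
      exact ⟨1, mem_detGroup_iff.mpr ⟨1, congruence_one _, map_one _⟩,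
        Or.inl (Subsingleton.elim _ _)⟩
    -- The inverse of the stabilising matrix is taken because its determinant is ±z'/z.
    refine ⟨_, mem_detGroup_iff.mpr ⟨_, congruence_inv hG, rfl⟩, ?_⟩
    rw [map_inv, map_mul, map_mul, map_inv, det_diagGL, det_diagGL, prod_lastScale hn,
      prod_lastScale hn]
    rcases det_reduceGL m G with h | h <;> rw [h]
    · left
      simp
    · right
      rw [← neg_eq_iff_eq_neg, mul_neg, mul_one, neg_mul, inv_neg, mul_neg]
      simp
  · rintro ⟨hs, hh, e, he, hz⟩
    obtain ⟨g, hg, rfl⟩ := mem_detGroup_iff.mp he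
    have hN : blockMatrix n d'.h = blockMatrix n d.h :=
      (blockMatrix_congr d.h d'.h hs.le hh fun k hk => by omega).symm
    rcases eq_or_ne n 0 with rfl | hn
    · exact ⟨1, Subsingleton.elim _ _⟩
    have hdet : GeneralLinearGroup.det (diagGL _ (lastScale n d'.z) * g⁻¹ *
        (diagGL _ (lastScale n d.z))⁻¹) = 1 ∨ GeneralLinearGroup.det
        (diagGL _ (lastScale n d'.z) * g⁻¹ * (diagGL _ (lastScale n d.z))⁻¹) = -1 := by
      rw [map_mul, map_mul, map_inv, map_inv, det_diagGL, det_diagGL, prod_lastScale hn,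
        prod_lastScale hn]
      rcases hz with hz | hz <;> rw [hz]
      · left; simp
      · right; simp
    obtain ⟨G, hG⟩ := mem_range_reduceGL m _ hdet
    refine ⟨G, ?_⟩
    rw [hG, hstab, hN, show ∀ a b c : GL (Fin n) (ZMod m), a⁻¹ * (a * b * c⁻¹) * c = b from
      fun a b c => by group]
    exact congruence_inv hg

/-- For `2s = n`, the elements `e` of `D_{(h₁,…,h_s)}` satisfy `e² h_s = h_s`. -/
theorem sq_mul_eq_of_mem_detGroup {m s : ℕ} (hs : 2 * s = n) (hm : m ≠ 0) {h : Fin s → ZMod m}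
    (hP : ∀ i, h i ∈ cosetReps m) (hdvd : ∀ i j, i ≤ j → h i ∣ h j) {e : (ZMod m)ˣ}
    (he : e ∈ detGroup n h) {k : Fin s} (hk : k.val + 1 = s) : (e : ZMod m) ^ 2 * h k = h k := by
  obtain ⟨g, hg, rfl⟩ := mem_detGroup_iff.mp he
  choose D hD hDh using hP
  obtain ⟨c, hc⟩ := hD k
  have hDne : ∀ i, D i ≠ 0 := fun i e => hm (by simpa [e] using hD i)
  have hDk : ∀ i, D i ∣ D k := fun i => dvd_of_natCast_dvd (hD i) (by
    rw [← hDh, ← hDh]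
    exact hdvd i k (Fin.le_def.mpr (by omega)))
  choose C hC using hDk
  set N : Matrix (Fin n) (Fin n) ℤ := blockMatrix n fun i => (D i : ℤ)
  -- J has blocks D k / D i, hence N J = -D k: an integral substitute for the inverse of N, up to
  -- the last divisor D k.
  set J : Matrix (Fin n) (Fin n) ℤ := blockMatrix n fun i => (C i : ℤ)
  have hNJ : N * J = -((D k : ℤ) • 1) := by
    ext i j
    change (N *ᵥ fun l => J l j) i = _
    rw [Matrix.neg_apply, Matrix.smul_apply, one_apply, smul_eq_mul]
    rcases even_or_odd_or_le s i with ⟨l, hl⟩ | ⟨l, hl⟩ | hi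
    · rw [blockMatrix_mulVec_even _ _ hl (j := ⟨2 * l.val + 1, by omega⟩) rfl,
        show J ⟨2 * l.val + 1, by omega⟩ j = _ from blockMatrix_odd (k := l) _ rfl j, hC l]
      by_cases hij : i = j
      · subst hij; simp [hl]
      · rw [if_neg hij, if_neg fun e => hij (Fin.ext (by omega))]
        simp
    · rw [blockMatrix_mulVec_odd _ _ hl (j := ⟨2 * l.val, by omega⟩) rfl,
        show J ⟨2 * l.val, by omega⟩ j = _ from blockMatrix_even (k := l) _ rfl j, hC l]
      by_cases hij : i = j
      · subst hij; simp [hl]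
      · rw [if_neg hij, if_neg fun e => hij (Fin.ext (by omega))]
        simp
    · omega
  choose r hr using ZMod.intCast_surjective (n := m)
  set G : Matrix (Fin n) (Fin n) ℤ := Matrix.of fun i j => r ((g : Matrix _ _ (ZMod m)) i j)
  have hG : G.map (Int.castRingHom (ZMod m)) = g := by
    ext i j
    simp [G, hr]
  have hN : N.map (Int.castRingHom (ZMod m)) = blockMatrix n h := by
    rw [blockMatrix_map]
    congr 1
    ext i
    simp [hDh]
  obtain ⟨E, hE⟩ : ∃ E : Matrix (Fin n) (Fin n) ℤ, G * N * Gᵀ = N + (m : ℤ) • E := by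
    have h0 : (Int.castRingHom (ZMod m)).mapMatrix (G * N * Gᵀ - N) = 0 := by
      rw [map_sub, map_mul, map_mul]
      simp only [RingHom.mapMatrix_apply]
      rw [transpose_map, hG, hN, sub_eq_zero]
      exact hg
    have : ∀ i j, (m : ℤ) ∣ (G * N * Gᵀ - N) i j := fun i j =>
      (ZMod.intCast_zmod_eq_zero_iff_dvd _ _).mp (congrFun (congrFun h0 i) j)
    choose E hE using this
    refine ⟨Matrix.of E, ?_⟩
    ext i j
    rw [Matrix.add_apply, Matrix.smul_apply, of_apply, smul_eq_mul, ← hE, Matrix.sub_apply]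
    ring
  -- Since m = D k * c, the relation N J = -D k gives N + m E = N (1 - c J E). Taking determinants
  -- and cancelling det N ≠ 0 yields det G² ≡ 1 modulo c, and c * D k = m.
  have hdet : G.det ^ 2 * N.det = N.det * (1 - (c : ℤ) • (J * E)).det := by
    have : N * (1 - (c : ℤ) • (J * E)) = G * N * Gᵀ := by
      rw [hE, Matrix.mul_sub, Matrix.mul_smul, ← Matrix.mul_assoc, hNJ, hc, Matrix.mul_one]
      rw [Matrix.neg_mul, Matrix.smul_mul, Matrix.one_mul, smul_neg, sub_neg_eq_add, smul_smul,
        mul_comm (c : ℤ), ← Nat.cast_mul]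
    rw [← det_mul, this, det_mul, det_mul, det_transpose]
    ring
  have hNdet : N.det ≠ 0 := by
    intro h0
    have := congrArg det hNJ
    rw [det_mul, h0, zero_mul, ← neg_smul, det_smul, det_one, mul_one] at this
    exact pow_ne_zero _ (neg_ne_zero.mpr (Nat.cast_ne_zero.mpr (hDne k))) this.symm
  have hG2 : (c : ℤ) ∣ G.det ^ 2 - 1 := by
    rw [mul_comm, mul_right_inj' hNdet] at hdet
    rw [hdet, ← ZMod.intCast_zmod_eq_zero_iff_dvd, Int.cast_sub, Int.cast_one, sub_eq_zero]
    have h1 : (Int.castRingHom (ZMod c)).mapMatrix (1 - (c : ℤ) • (J * E)) = 1 := by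
      rw [map_sub, map_one, sub_eq_self]
      ext i j
      rw [RingHom.mapMatrix_apply, Matrix.map_apply, Matrix.smul_apply, smul_eq_mul]
      simp
    have h2 := (Int.castRingHom (ZMod c)).map_det (1 - (c : ℤ) • (J * E))
    rw [h1, det_one] at h2
    exact h2
  obtain ⟨y, hy⟩ := hG2
  have hdetG : ((G.det : ℤ) : ZMod m) = (GeneralLinearGroup.det g : ZMod m) := by
    have := (Int.castRingHom (ZMod m)).map_det G
    rw [RingHom.mapMatrix_apply, hG] at this
    exact this
  rw [← sub_eq_zero, ← hdetG, hDh]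
  have : ((G.det : ℤ) : ZMod m) ^ 2 * D k - D k = (((G.det ^ 2 - 1) * D k : ℤ) : ZMod m) := by
    push_cast
    ring
  rw [this, hy, ZMod.intCast_zmod_eq_zero_iff_dvd]
  exact ⟨y, by rw [hc]; push_cast; ring⟩

end Congruence

/-! ### Twisted bases -/

section Twisted

open Module
open scoped commutatorElement

variable {K : Type*} [Field K] {A : Type*} [Ring A] [Algebra K A] {Γ : Type*} [AddCommGroup Γ]

/-- The basis `b` exhibits `A` as the twisted group algebra of `Γ` with respect to `c`. -/
def IsTwistedBasis (b : Basis Γ K A) (c : Γ → Γ → Kˣ) : Prop :=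
  ∀ γ δ, b γ * b δ = c γ δ • b (γ + δ)

omit [AddCommGroup Γ] in
theorem smul_basis_index_eq {b : Basis Γ K A} {k l : Kˣ} {γ δ : Γ} (h : k • b γ = l • b δ) :
    γ = δ := by
  classical
  have := congrArg (fun x => b.repr x γ) h
  simp only [Units.smul_def, map_smul, Basis.repr_self, Finsupp.smul_apply, Finsupp.single_apply,
    smul_eq_mul] at this
  by_contra hne
  rw [if_pos trivial, if_neg (Ne.symm hne), mul_one, mul_zero] at this
  exact k.ne_zero this

omit [AddCommGroup Γ] in
theorem smul_basis_inj {b : Basis Γ K A} {k l : Kˣ} {γ : Γ} (h : k • b γ = l • b γ) : k = l :=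
  Units.ext (smul_left_injective K (b.ne_zero γ) h)

namespace IsTwistedBasis

variable {b : Basis Γ K A} {c : Γ → Γ → Kˣ} (hb : IsTwistedBasis b c)

include hb

theorem cocycle (γ δ ε : Γ) : c γ δ * c (γ + δ) ε = c δ ε * c γ (δ + ε) := by
  have h := mul_assoc (b γ) (b δ) (b ε)
  rw [hb, hb, smul_mul_assoc, mul_smul_comm, hb, hb, smul_smul, smul_smul, add_assoc] at h
  exact smul_basis_inj h

theorem cocycle_zero_left (δ : Γ) : c 0 δ = c 0 0 := by
  have := hb.cocycle 0 0 δ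
  rw [zero_add, zero_add] at this
  exact (mul_right_cancel this).symm

theorem basis_zero : b 0 = c 0 0 • (1 : A) := by
  have h : LinearMap.mulLeft K (b 0) = LinearMap.mulLeft K (c 0 0 • (1 : A)) := by
    refine b.ext fun δ => ?_
    rw [LinearMap.mulLeft_apply, LinearMap.mulLeft_apply, hb, hb.cocycle_zero_left, zero_add,
      smul_mul_assoc, one_mul]
  simpa using congrArg (fun f => f (1 : A)) h

theorem isUnit (γ : Γ) : IsUnit (b γ) := by
  have h : ∀ γ, b γ * ((c γ (-γ) * c 0 0)⁻¹ • b (-γ)) = 1 := fun γ => by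
    rw [mul_smul_comm, hb, add_neg_cancel, hb.basis_zero, smul_smul, smul_smul, mul_assoc,
      inv_mul_cancel, one_smul]
  have h' : ((c (-γ) γ * c 0 0)⁻¹ • b (-γ)) * b γ = 1 := by
    have := h (-γ)
    rwa [neg_neg, mul_smul_comm, ← smul_mul_assoc] at this
  exact isUnit_iff_exists_and_exists.mpr ⟨⟨_, h γ⟩, ⟨_, h'⟩⟩

theorem mul_eq_smul_mul (γ δ : Γ) : b γ * b δ = (c γ δ / c δ γ) • (b δ * b γ) := by
  rw [hb, hb, smul_smul, div_mul_cancel, add_comm]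

theorem eq_div_of_mul_eq {k : Kˣ} {γ δ : Γ} (h : b γ * b δ = k • (b δ * b γ)) :
    k = c γ δ / c δ γ := by
  rw [hb, hb, smul_smul, add_comm δ γ] at h
  rw [eq_div_iff_mul_eq']
  exact (smul_basis_inj h).symm

/-- Moving b γ past b δ * b ε one factor at a time shows that the pairing is multiplicative. -/
theorem div_add_right (γ δ ε : Γ) :
    c γ (δ + ε) / c (δ + ε) γ = (c γ δ / c δ γ) * (c γ ε / c ε γ) := by
  refine (hb.eq_div_of_mul_eq ?_).symm
  have h : ∀ x y : A, c δ ε • x = c δ ε • y → x = y := fun x y h => by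
    simpa using congrArg ((c δ ε)⁻¹ • ·) h
  apply h
  rw [← mul_smul_comm, ← hb, smul_comm, ← smul_mul_assoc, ← hb, ← mul_assoc,
    hb.mul_eq_smul_mul γ δ, smul_mul_assoc, mul_assoc, hb.mul_eq_smul_mul γ ε, mul_smul_comm,
    smul_smul, mul_assoc]

theorem div_add_left (γ δ ε : Γ) :
    c (γ + δ) ε / c ε (γ + δ) = (c γ ε / c ε γ) * (c δ ε / c ε δ) := by
  rw [← inv_div, hb.div_add_right, mul_inv, inv_div, inv_div]

theorem repr_mul [DecidableEq Γ] (x y : A) (γ : Γ) : b.repr (x * y) γ =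
    ∑ α ∈ (b.repr x).support, ∑ β ∈ (b.repr y).support,
      if α + β = γ then b.repr x α * b.repr y β * c α β else 0 := by
  conv_lhs => rw [← b.linearCombination_repr x, ← b.linearCombination_repr y,
    Finsupp.linearCombination_apply, Finsupp.linearCombination_apply, Finsupp.sum, Finsupp.sum,
    Finset.sum_mul_sum]
  simp only [map_sum, Finsupp.finsetSum_apply, smul_mul_smul_comm, hb _ _]
  refine Finset.sum_congr rfl fun α _ => Finset.sum_congr rfl fun β _ => ?_
  rw [Units.smul_def, smul_smul, map_smul, Basis.repr_self, Finsupp.smul_apply,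
    Finsupp.single_apply, smul_eq_mul, mul_ite, mul_one, mul_zero]

/-- A degree that is a sum of support elements in only one way receives a single term, so nothing
cancels. -/
theorem repr_mul_ne_zero {x y : A} {α β : Γ} (hα : α ∈ (b.repr x).support)
    (hβ : β ∈ (b.repr y).support)
    (h : UniqueAdd (b.repr x).support (b.repr y).support α β) : b.repr (x * y) (α + β) ≠ 0 := by
  classical
  rw [hb.repr_mul, Finset.sum_eq_single α, Finset.sum_eq_single β, if_pos rfl]
  · exact mul_ne_zero (mul_ne_zero (Finsupp.mem_support_iff.mp hα) (Finsupp.mem_support_iff.mp hβ))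
      (Units.ne_zero _)
  · exact fun β' hβ' hne => if_neg fun e => hne (h hα hβ' e).2
  · exact fun h => (h hβ).elim
  · exact fun α' hα' hne => Finset.sum_eq_zero fun β' hβ' => if_neg fun e => hne (h hα' hβ' e).1
  · exact fun h => (h hα).elim

/-- If `Γ` is torsion free, units of a twisted group algebra are homogeneous. -/
theorem exists_eq_smul_of_mul_eq_one [TwoUniqueSums Γ] {x y : A} (hxy : x * y = 1)
    (h0 : (1 : A) ≠ 0) : ∃ (k : Kˣ) (γ : Γ), x = k • b γ := by
  classical
  have hone : ∀ γ, b.repr (x * y) γ ≠ 0 → γ = 0 := fun γ hγ => by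
    by_contra hne
    have : (1 : A) = (c 0 0)⁻¹ • b 0 := by rw [hb.basis_zero, inv_smul_smul]
    rw [hxy, this, Units.smul_def, map_smul, Basis.repr_self, Finsupp.smul_apply,
      Finsupp.single_apply, if_neg (Ne.symm hne), smul_zero] at hγ
    exact hγ rfl
  have hx : (b.repr x).support.Nonempty := by
    rw [Finsupp.support_nonempty_iff, ne_eq, LinearEquiv.map_eq_zero_iff]
    rintro rfl
    exact h0 (by rw [← hxy, zero_mul])
  have hy : (b.repr y).support.Nonempty := by
    rw [Finsupp.support_nonempty_iff, ne_eq, LinearEquiv.map_eq_zero_iff]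
    rintro rfl
    exact h0 (by rw [← hxy, mul_zero])
  -- Otherwise two distinct pairs of degrees have unique sums. Both sums carry non-zero coefficients
  -- of x * y = 1, so both are 0, against uniqueness.
  have hcard : ¬ 1 < (b.repr x).support.card * (b.repr y).support.card := by
    intro hlt
    obtain ⟨p, hp, p', hp', hne, hu, hu'⟩ := TwoUniqueSums.uniqueAdd_of_one_lt_card hlt
    rw [Finset.mem_product] at hp hp'
    have h1 := hone _ (hb.repr_mul_ne_zero hp.1 hp.2 hu)
    have h2 := hone _ (hb.repr_mul_ne_zero hp'.1 hp'.2 hu')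
    have h3 := hu hp'.1 hp'.2 (h2.trans h1.symm)
    exact hne (Prod.ext h3.1.symm h3.2.symm)
  have hx1 : (b.repr x).support.card = 1 := by
    have h1 := hx.card_pos
    have h2 := hy.card_pos
    nlinarith
  obtain ⟨γ, k, hk, hkγ⟩ := Finsupp.card_support_eq_one'.mp hx1
  refine ⟨Units.mk0 k hk, γ, ?_⟩
  rw [Units.smul_mk0]
  apply b.repr.injective
  rw [hkγ, map_smul, Basis.repr_self, Finsupp.smul_single, smul_eq_mul, mul_one]

omit hb in
theorem nontrivial (b : Basis Γ K A) : Nontrivial A := ⟨⟨b 0, 0, b.ne_zero 0⟩⟩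

theorem exists_eq_smul_of_isUnit [TwoUniqueSums Γ] {x : A} (hx : IsUnit x) :
    ∃ (k : Kˣ) (γ : Γ), x = k • b γ := by
  have := nontrivial b
  obtain ⟨u, rfl⟩ := hx
  exact hb.exists_eq_smul_of_mul_eq_one u.mul_inv one_ne_zero

theorem commutatorElement_eq {u v : Aˣ} {k l : Kˣ} {γ δ : Γ} (hu : (u : A) = k • b γ)
    (hv : (v : A) = l • b δ) : ⁅u, v⁆ = scalarUnits K A (c γ δ / c δ γ) := by
  rw [commutatorElement_def, mul_inv_eq_iff_eq_mul, mul_inv_eq_iff_eq_mul]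
  ext
  have : ((scalarUnits K A (c γ δ / c δ γ) : Aˣ) : A) = (c γ δ / c δ γ) • (1 : A) := by
    rw [Units.smul_def, ← Algebra.algebraMap_eq_smul_one]
    rfl
  rw [Units.val_mul, Units.val_mul, Units.val_mul, this, hu, hv, smul_mul_smul_comm,
    hb.mul_eq_smul_mul, mul_assoc, smul_mul_smul_comm, smul_mul_assoc, one_mul, mul_comm l k,
    smul_comm]

/-- The commutator group of the unit group of a twisted group algebra. -/
theorem commutator_eq [TwoUniqueSums Γ] : commutator Aˣ =
    (Subgroup.closure {ζ : Kˣ | ∃ γ δ, c γ δ / c δ γ = ζ}).map (scalarUnits K A) := by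
  rw [commutator_eq_closure, MonoidHom.map_closure]
  congr 1
  ext x
  constructor
  · rintro ⟨u, v, rfl⟩
    obtain ⟨k, γ, hu⟩ := hb.exists_eq_smul_of_isUnit u.isUnit
    obtain ⟨l, δ, hv⟩ := hb.exists_eq_smul_of_isUnit v.isUnit
    exact ⟨_, ⟨γ, δ, rfl⟩, (hb.commutatorElement_eq hu hv).symm⟩
  · rintro ⟨_, ⟨γ, δ, rfl⟩, rfl⟩
    exact ⟨(hb.isUnit γ).unit, (hb.isUnit δ).unit,
      hb.commutatorElement_eq (one_smul Kˣ _).symm (one_smul Kˣ _).symm⟩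

omit hb in
theorem scalarUnits_injective (b : Basis Γ K A) : Function.Injective (scalarUnits K A) := by
  have := nontrivial b
  exact Units.map_injective (algebraMap K A).injective

theorem commutatorGroup_eq [TwoUniqueSums Γ] :
    commutatorGroup K A = Subgroup.closure {ζ : Kˣ | ∃ γ δ, c γ δ / c δ γ = ζ} := by
  rw [commutatorGroup, hb.commutator_eq, Subgroup.comap_map_eq_self_of_injective]
  exact scalarUnits_injective b

/-- An isomorphism of twisted group algebras is graded. -/
theorem exists_addEquiv_of_algEquiv [TwoUniqueSums Γ]
    {B : Type*} [Ring B] [Algebra K B] {Δ : Type*} [AddCommGroup Δ] [TwoUniqueSums Δ]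
    {b' : Basis Δ K B} {c' : Δ → Δ → Kˣ} (hb' : IsTwistedBasis b' c') (φ : A ≃ₐ[K] B) :
    ∃ ψ : Γ ≃+ Δ, (∀ γ, (Submodule.span K {b γ}).map φ.toLinearMap = Submodule.span K {b' (ψ γ)}) ∧
      ∀ γ δ, c' (ψ γ) (ψ δ) / c' (ψ δ) (ψ γ) = c γ δ / c δ γ := by
  have smulφ : ∀ (k : Kˣ) (x : A), φ (k • x) = k • φ x := fun k x => by
    rw [Units.smul_def, map_smul, Units.smul_def]
  -- Basis elements are units, so their images are units and therefore homogeneous. This defines ψ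
  -- on degrees.
  choose k ψ hψ using fun γ => hb'.exists_eq_smul_of_isUnit ((hb.isUnit γ).map φ)
  choose l χ hχ using fun δ => hb.exists_eq_smul_of_isUnit ((hb'.isUnit δ).map φ.symm)
  have hadd : ∀ γ δ, ψ (γ + δ) = ψ γ + ψ δ := fun γ δ => by
    have h1 := congrArg φ (hb γ δ)
    rw [map_mul, smulφ, hψ, hψ, hψ, smul_mul_smul_comm, hb', smul_smul, smul_smul] at h1
    exact (smul_basis_index_eq h1).symm
  have hinj : Function.Injective ψ := fun γ δ h => by
    have h1 : φ ((k γ)⁻¹ • b γ) = φ ((k δ)⁻¹ • b δ) := by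
      rw [smulφ, smulφ, hψ, hψ, inv_smul_smul, inv_smul_smul, h]
    exact smul_basis_index_eq (φ.injective h1)
  have hsurj : Function.Surjective ψ := fun δ => ⟨χ δ, by
    have h1 := congrArg φ (hχ δ)
    rw [smulφ, hψ, smul_smul] at h1
    have h2 : (1 : Kˣ) • b' δ = (l δ * k (χ δ)) • b' (ψ (χ δ)) := by
      rw [one_smul, ← h1]
      exact (φ.apply_symm_apply _).symm
    exact (smul_basis_index_eq h2).symm⟩
  refine ⟨AddEquiv.ofBijective (AddMonoidHom.mk' ψ hadd) ⟨hinj, hsurj⟩, fun γ => ?_, fun γ δ => ?_⟩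
  · change _ = Submodule.span K {b' (ψ γ)}
    rw [Submodule.map_span, Set.image_singleton]
    change Submodule.span K {φ (b γ)} = _
    rw [hψ]
    exact Submodule.span_singleton_group_smul_eq K (k γ) _
  · change c' (ψ γ) (ψ δ) / c' (ψ δ) (ψ γ) = _
    refine (hb'.eq_div_of_mul_eq ?_).symm
    have h1 := congrArg φ (hb.mul_eq_smul_mul γ δ)
    rw [smulφ, map_mul, map_mul, hψ, hψ, smul_mul_smul_comm, smul_mul_smul_comm, mul_comm (k δ),
      smul_comm] at h1
    simpa using congrArg ((k γ * k δ)⁻¹ • ·) h1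

end IsTwistedBasis

/-! ### Trivialising symmetric cocycles, and isomorphisms from equal pairings. -/

/-- The extension of `Γ` by `G` defined by a symmetric cocycle. -/
@[ext]
structure CocycleExtension {G : Type*} (f : Γ → Γ → G) where
  /-- The component in the kernel `G`. -/
  coeff : G
  /-- The image in `Γ`. -/
  deg : Γ

/-- Symmetric cocycles on free abelian groups are coboundaries. -/
theorem exists_coboundary [Module.Free ℤ Γ] {G : Type*} [CommGroup G] (f : Γ → Γ → G)
    (hf : ∀ γ δ ε, f γ δ * f (γ + δ) ε = f δ ε * f γ (δ + ε)) (hsymm : ∀ γ δ, f γ δ = f δ γ) :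
    ∃ h : Γ → G, ∀ γ δ, h γ * h δ = f γ δ * h (γ + δ) := by
  let _ : Add (CocycleExtension f) :=
    ⟨fun x y => ⟨x.coeff * y.coeff * f x.deg y.deg, x.deg + y.deg⟩⟩
  let _ : Zero (CocycleExtension f) := ⟨⟨(f 0 0)⁻¹, 0⟩⟩
  let _ : Neg (CocycleExtension f) :=
    ⟨fun x => ⟨x.coeff⁻¹ * (f (-x.deg) x.deg)⁻¹ * (f 0 0)⁻¹, -x.deg⟩⟩
  have add_def : ∀ x y : CocycleExtension f,
    x + y = ⟨x.coeff * y.coeff * f x.deg y.deg, x.deg + y.deg⟩ :=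
    fun _ _ => rfl
  have zero_def : (0 : CocycleExtension f) = ⟨(f 0 0)⁻¹, 0⟩ := rfl
  have neg_def : ∀ x : CocycleExtension f,
    -x = ⟨x.coeff⁻¹ * (f (-x.deg) x.deg)⁻¹ * (f 0 0)⁻¹, -x.deg⟩ := fun _ => rfl
  have hf0 : ∀ γ, f 0 γ = f 0 0 := fun γ => by
    have := hf 0 0 γ
    rw [zero_add, zero_add] at this
    exact (mul_right_cancel this).symm
  let _ : AddGroup (CocycleExtension f) := AddGroup.ofLeftAxioms
    (fun x y z => by
      rw [add_def, add_def, add_def, add_def]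
      refine CocycleExtension.ext ?_ (add_assoc _ _ _)
      change x.coeff * y.coeff * f x.deg y.deg * z.coeff * f (x.deg + y.deg) z.deg =
        x.coeff * (y.coeff * z.coeff * f y.deg z.deg) * f x.deg (y.deg + z.deg)
      calc _ = x.coeff * y.coeff * z.coeff * (f x.deg y.deg * f (x.deg + y.deg) z.deg) := by
            simp only [mul_left_comm, mul_comm]
        _ = _ := by rw [hf]; simp only [mul_assoc])
    (fun x => by
      rw [add_def, zero_def]
      refine CocycleExtension.ext ?_ (zero_add _)
      change (f 0 0)⁻¹ * x.coeff * f 0 x.deg = x.coeff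
      rw [hf0 x.deg, mul_right_comm, inv_mul_cancel, one_mul])
    (fun x => by
      rw [add_def, neg_def, zero_def]
      refine CocycleExtension.ext ?_ (neg_add_cancel _)
      change x.coeff⁻¹ * (f (-x.deg) x.deg)⁻¹ * (f 0 0)⁻¹ * x.coeff * f (-x.deg) x.deg = (f 0 0)⁻¹
      calc _ = x.coeff⁻¹ * x.coeff * ((f (-x.deg) x.deg)⁻¹ * f (-x.deg) x.deg) * (f 0 0)⁻¹ := by
            simp only [mul_assoc, mul_left_comm, mul_comm]
        _ = _ := by rw [inv_mul_cancel, inv_mul_cancel, one_mul, one_mul])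
  let _ : AddCommGroup (CocycleExtension f) :=
    { (inferInstance : AddGroup (CocycleExtension f)) with
      add_comm := fun x y => by
        rw [add_def, add_def, hsymm, mul_comm x.coeff, add_comm x.deg] }
  let p : CocycleExtension f →ₗ[ℤ] Γ := AddMonoidHom.toIntLinearMap
    { toFun := fun x => x.deg
      map_zero' := rfl
      map_add' := fun _ _ => rfl }
  -- By symmetry the extension is an abelian group, and it splits because Γ is free. The inverse of
  -- the coefficient of the splitting trivialises f.
  obtain ⟨σ, hσ⟩ := Module.projective_lifting_property p LinearMap.id
    (fun γ => ⟨⟨1, γ⟩, rfl⟩)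
  have hσ2 : ∀ γ, (σ γ).deg = γ := fun γ => congrArg (fun g => g γ) hσ
  refine ⟨fun γ => ((σ γ).coeff)⁻¹, fun γ δ => ?_⟩
  have h1 : (σ (γ + δ)).coeff = (σ γ).coeff * (σ δ).coeff * f γ δ := by
    rw [map_add, add_def, hσ2, hσ2]
  simp only
  rw [h1, mul_inv, mul_inv, mul_comm (f γ δ), inv_mul_cancel_right]

/-- Twisted group algebras of free abelian groups with the same commutator pairing are
isomorphic. -/
theorem IsTwistedBasis.exists_algEquiv_of_addEquiv {b : Basis Γ K A} {c : Γ → Γ → Kˣ}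
    (hb : IsTwistedBasis b c) [Module.Free ℤ Γ] {B : Type*} [Ring B] [Algebra K B] {Δ : Type*}
    [AddCommGroup Δ] {b' : Basis Δ K B} {c' : Δ → Δ → Kˣ} (hb' : IsTwistedBasis b' c')
    (ψ : Γ ≃+ Δ) (hψ : ∀ γ δ, c' (ψ γ) (ψ δ) / c' (ψ δ) (ψ γ) = c γ δ / c δ γ) :
    ∃ φ : A ≃ₐ[K] B, ∀ γ, (Submodule.span K {b γ}).map φ.toLinearMap =
      Submodule.span K {b' (ψ γ)} := by
  -- Equality of the pairings says exactly that the quotient of the two cocycles is symmetric.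
  -- Rescaling b' by h then turns its cocycle into c.
  obtain ⟨h, hh⟩ := exists_coboundary (fun γ δ => c γ δ / c' (ψ γ) (ψ δ))
    (fun γ δ ε => by
      rw [div_mul_div_comm, div_mul_div_comm, hb.cocycle, map_add, map_add, hb'.cocycle])
    (fun γ δ => by
      have := hψ γ δ
      rw [div_eq_div_iff_mul_eq_mul] at this ⊢
      rw [mul_comm, ← mul_comm (c γ δ), ← this, mul_comm])
  let b'' : Basis Γ K B := (b'.reindex ψ.symm.toEquiv).unitsSMul h
  have hb'' : ∀ γ, b'' γ = h γ • b' (ψ γ) := fun γ => by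
    simp [b'', Basis.unitsSMul_apply]
  let e : A ≃ₗ[K] B := b.equiv b'' (Equiv.refl Γ)
  have he : ∀ γ, e (b γ) = h γ • b' (ψ γ) := fun γ => by
    rw [Basis.equiv_apply, ← hb'']
    rfl
  have hmul : ∀ x y, e (x * y) = e x * e y := by
    have h1 : (LinearMap.mul K A).compr₂ e.toLinearMap =
        (LinearMap.mul K B).compl₁₂ e.toLinearMap e.toLinearMap := by
      refine b.ext fun γ => b.ext fun δ => ?_
      change e (b γ * b δ) = e (b γ) * e (b δ)
      rw [hb, he, he, smul_mul_smul_comm, hb', Units.smul_def, map_smul, he, ← Units.smul_def,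
        smul_smul, smul_smul, map_add, hh, mul_right_comm, div_mul_cancel]
    exact fun x y => congrArg (fun g => g x y) h1
  -- 1 need not be a basis vector, but multiplicativity and surjectivity make e 1 a left identity of
  -- B.
  have hone : e 1 = 1 := by
    obtain ⟨x, hx⟩ := e.surjective 1
    rw [← mul_one (e 1), ← hx, ← hmul, one_mul]
  refine ⟨AlgEquiv.ofLinearEquiv e hone hmul, fun γ => ?_⟩
  rw [Submodule.map_span, Set.image_singleton]
  change Submodule.span K {e (b γ)} = _
  rw [he]
  exact Submodule.span_singleton_group_smul_eq K (h γ) _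

end Twisted

/-! ### Homogeneous bases of quantum tori -/

section QuantumTorus

open Module

theorem IsQuantumTorus.exists_isTwistedBasis {K : Type*} [Field K] {A : Type*} [Ring A]
    [Algebra K A] {Γ : Type*} [AddCommGroup Γ] [DecidableEq Γ] {𝒜 : Γ → Submodule K A}
    [GradedAlgebra 𝒜] (h : IsQuantumTorus K 𝒜) :
    ∃ (b : Basis Γ K A) (c : Γ → Γ → Kˣ), IsTwistedBasis b c ∧
      ∀ γ, 𝒜 γ = Submodule.span K {b γ} := by
  let v : ∀ γ, Basis Unit K (𝒜 γ) := fun γ => basisUnique Unit (h.finrank_eq_one γ)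
  have hint := DirectSum.Decomposition.isInternal 𝒜
  let b : Basis Γ K A := (hint.collectedBasis v).reindex (Equiv.sigmaPUnit.{0} Γ)
  have hmem : ∀ γ, b γ ∈ 𝒜 γ := fun γ => by
    rw [Basis.reindex_apply]
    exact hint.collectedBasis_mem v ⟨γ, ()⟩
  have hspan : ∀ γ, 𝒜 γ = Submodule.span K {b γ} := fun γ => by
    refine le_antisymm (fun x hx => ?_) ((Submodule.span_singleton_le_iff_mem _ _).mpr (hmem γ))
    obtain ⟨k, hk⟩ := (finrank_eq_one_iff_of_nonzero' (⟨b γ, hmem γ⟩ : 𝒜 γ)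
      (fun e => b.ne_zero γ (congrArg Subtype.val e))).mp (h.finrank_eq_one γ) ⟨x, hx⟩
    exact Submodule.mem_span_singleton.mpr ⟨k, congrArg Subtype.val hk⟩
  have hc : ∀ γ δ, ∃ k : Kˣ, b γ * b δ = k • b (γ + δ) := fun γ δ => by
    have h1 : b γ * b δ ∈ 𝒜 (γ + δ) := SetLike.mul_mem_graded (hmem γ) (hmem δ)
    rw [hspan, Submodule.mem_span_singleton] at h1
    obtain ⟨k, hk⟩ := h1
    have hne : b γ * b δ ≠ 0 := fun e =>
      b.ne_zero δ (((h.isUnit_of_mem γ _ (hmem γ) (b.ne_zero γ)).mul_right_eq_zero).mp e)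
    refine ⟨Units.mk0 k ?_, hk.symm⟩
    rintro rfl
    exact hne (by rw [← hk, zero_smul])
  choose c hc using hc
  exact ⟨b, c, hc, hspan⟩

end QuantumTorus

/-! ### Pairings given by matrices over `ℤ/m` -/

section Pairing

open Module Matrix

variable {K : Type*} [Field K]

/-- The character `x ↦ q ^ x` of `ℤ/m`, where `m` is the order of `q`. -/
def powChar (q : Kˣ) (x : ZMod (orderOf q)) : Kˣ := q ^ x.val

variable {q : Kˣ} [NeZero (orderOf q)]

omit [NeZero (orderOf q)] in
theorem powChar_natCast (k : ℕ) : powChar q (k : ZMod (orderOf q)) = q ^ k := by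
  rw [powChar, ZMod.val_natCast, pow_mod_orderOf]

theorem powChar_add (x y : ZMod (orderOf q)) : powChar q (x + y) = powChar q x * powChar q y := by
  rw [powChar, ZMod.val_add, pow_mod_orderOf, pow_add]
  rfl

theorem powChar_injective : Function.Injective (powChar q) := fun x y h =>
  ZMod.val_injective _ (pow_injOn_Iio_orderOf (ZMod.val_lt x) (ZMod.val_lt y) h)

omit [NeZero (orderOf q)] in
theorem powChar_zero : powChar q 0 = 1 := by
  simp [powChar]

theorem powChar_neg (x : ZMod (orderOf q)) : powChar q (-x) = (powChar q x)⁻¹ := by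
  rw [eq_inv_iff_mul_eq_one, ← powChar_add, neg_add_cancel, powChar_zero]

theorem powChar_intCast_mul (k : ℤ) (x : ZMod (orderOf q)) :
    powChar q ((k : ZMod (orderOf q)) * x) = powChar q x ^ k := by
  let f : ZMod (orderOf q) →+ Additive Kˣ :=
    { toFun := fun x => Additive.ofMul (powChar q x)
      map_zero' := powChar_zero
      map_add' := powChar_add }
  have := map_zsmul f k x
  rw [zsmul_eq_mul] at this
  exact this

theorem powChar_mul (x y : ZMod (orderOf q)) : powChar q (x * y) = powChar q y ^ x.val := by
  have := powChar_intCast_mul (x.val : ℤ) y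
  rwa [Int.cast_natCast, ZMod.natCast_zmod_val, zpow_natCast] at this

theorem powChar_sum {ι : Type*} (s : Finset ι) (f : ι → ZMod (orderOf q)) :
    powChar q (∑ i ∈ s, f i) = ∏ i ∈ s, powChar q (f i) := by
  let g : ZMod (orderOf q) →+ Additive Kˣ :=
    { toFun := fun x => Additive.ofMul (powChar q x)
      map_zero' := powChar_zero
      map_add' := powChar_add }
  exact map_sum g f s

theorem exists_powChar_eq {ζ : Kˣ} (h : ζ ∈ Subgroup.zpowers q) : ∃ x, powChar q x = ζ := by
  obtain ⟨k, rfl⟩ := h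
  refine ⟨((k : ℤ) : ZMod (orderOf q)) * 1, ?_⟩
  rw [powChar_intCast_mul]
  have := powChar_natCast (q := q) 1
  rw [Nat.cast_one, pow_one] at this
  rw [this]

/-- The bilinear pairing `(x, y) ↦ xᵀ M y` on `ℤⁿ` with values in `ℤ/m`. -/
def pairing {m n : ℕ} (M : Matrix (Fin n) (Fin n) (ZMod m)) (x y : Fin n → ℤ) : ZMod m :=
  (fun i => (x i : ZMod m)) ⬝ᵥ M *ᵥ fun j => (y j : ZMod m)

theorem pairing_eq_sum {m n : ℕ} (M : Matrix (Fin n) (Fin n) (ZMod m)) (x y : Fin n → ℤ) :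
    pairing M x y = ∑ i, ∑ j, (x i : ZMod m) * ((y j : ZMod m) * M i j) := by
  simp only [pairing, dotProduct, mulVec, Finset.mul_sum]
  exact Finset.sum_congr rfl fun i _ => Finset.sum_congr rfl fun j _ => by ring

theorem pairing_congruence {m n : ℕ} (G : GL (Fin n) ℤ) (M : Matrix (Fin n) (Fin n) (ZMod m))
    (x y : Fin n → ℤ) : pairing (congruence (reduceGL m G) M) x y =
      pairing M (x ᵥ* (G : Matrix (Fin n) (Fin n) ℤ)) (y ᵥ* (G : Matrix (Fin n) (Fin n) ℤ)) := by
  have h : ∀ x : Fin n → ℤ, (fun i => (((x ᵥ* (G : Matrix (Fin n) (Fin n) ℤ)) i : ℤ) : ZMod m)) =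
      (fun i => (x i : ZMod m)) ᵥ* (reduceGL m G : Matrix (Fin n) (Fin n) (ZMod m)) := fun x => by
    ext i
    simp [vecMul, dotProduct]
  rw [pairing, pairing, h, h, congruence, ← mulVec_mulVec, ← mulVec_mulVec, ← dotProduct_mulVec,
    mulVec_transpose]

theorem pairing_single {m n : ℕ} (M : Matrix (Fin n) (Fin n) (ZMod m)) (i j : Fin n) :
    pairing M (Pi.single i 1) (Pi.single j 1) = M i j := by
  have h : ∀ i : Fin n, (fun k => (((Pi.single i 1 : Fin n → ℤ) k : ℤ) : ZMod m)) =
      Pi.single i 1 := fun i => by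
    ext k
    by_cases hk : k = i
    · subst hk; simp
    · simp [hk]
  rw [pairing, h, h]
  simp

variable {n : ℕ} {A : Type*} [Ring A] [Algebra K A] {b : Basis (Fin n → ℤ) K A}
  {c : (Fin n → ℤ) → (Fin n → ℤ) → Kˣ}

/-- The commutator pairing of `c` is `q ^ (xᵀ M y)`. -/
def HasPairing (q : Kˣ) (c : (Fin n → ℤ) → (Fin n → ℤ) → Kˣ)
    (M : Matrix (Fin n) (Fin n) (ZMod (orderOf q))) : Prop :=
  ∀ x y, c x y / c y x = powChar q (pairing M x y)

/-- The commutator pairing is determined by its values on the standard basis. -/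
theorem IsTwistedBasis.div_eq_prod (hb : IsTwistedBasis b c) (x y : Fin n → ℤ) :
    c x y / c y x = ∏ i, ∏ j, ((c (Pi.single i 1) (Pi.single j 1) /
      c (Pi.single j 1) (Pi.single i 1)) ^ y j) ^ x i := by
  let L : (Fin n → ℤ) →+ (Fin n → ℤ) →+ Additive Kˣ :=
    AddMonoidHom.mk' (fun x => AddMonoidHom.mk' (fun y => Additive.ofMul (c x y / c y x))
      fun y z => congrArg Additive.ofMul (hb.div_add_right x y z))
      fun x y => AddMonoidHom.ext fun z => congrArg Additive.ofMul (hb.div_add_left x y z)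
  have hsum : ∀ x : Fin n → ℤ, x = ∑ i, x i • (Pi.single i 1 : Fin n → ℤ) := fun x => by
    ext k
    simp [Pi.single_apply]
  have h1 : L x y = ∑ i, ∑ j, x i • y j • L (Pi.single i 1) (Pi.single j 1) := by
    have h3 : ∀ z, L z y = ∑ j, y j • L z (Pi.single j 1) := fun z => by
      conv_lhs => rw [hsum y]
      simp only [map_sum, map_zsmul]
    conv_lhs => rw [hsum x]
    simp only [map_sum, map_zsmul, AddMonoidHom.finsetSum_apply]
    refine Finset.sum_congr rfl fun i _ => ?_
    change x i • L (Pi.single i 1) y = _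
    rw [h3]
    exact (Finset.sum_zsmul _ _ _).symm
  exact h1

theorem IsTwistedBasis.hasPairing (hb : IsTwistedBasis b c)
    (M : Matrix (Fin n) (Fin n) (ZMod (orderOf q)))
    (hM : ∀ i j, c (Pi.single i 1) (Pi.single j 1) / c (Pi.single j 1) (Pi.single i 1) =
      powChar q (M i j)) : HasPairing q c M := fun x y => by
  rw [hb.div_eq_prod, pairing_eq_sum, powChar_sum]
  simp only [powChar_sum, powChar_intCast_mul, hM]

theorem IsTwistedBasis.mem_commutatorGroup (hb : IsTwistedBasis b c) (x y : Fin n → ℤ) :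
    c x y / c y x ∈ commutatorGroup K A := by
  rw [hb.commutatorGroup_eq]
  exact Subgroup.subset_closure ⟨x, y, rfl⟩

/-- The commutator pairing of a quantum torus whose commutator group is generated by `q`. -/
theorem IsTwistedBasis.exists_hasPairing (hb : IsTwistedBasis b c)
    (hq : Subgroup.zpowers q = commutatorGroup K A) :
    ∃ M : Matrix (Fin n) (Fin n) (ZMod (orderOf q)), (∀ i, M i i = 0) ∧ (∀ i j, M j i = -M i j) ∧
      (∀ a : ZMod (orderOf q), a • M = 0 → a = 0) ∧ HasPairing q c M := by
  choose M hM using fun i j : Fin n => exists_powChar_eq (q := q)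
    (hq ▸ hb.mem_commutatorGroup (Pi.single i 1) (Pi.single j 1))
  have hP := hb.hasPairing (Matrix.of M) fun i j => (hM i j).symm
  refine ⟨Matrix.of M, fun i => ?_, fun i j => ?_, fun a ha => ?_, hP⟩
  · apply powChar_injective
    rw [powChar_zero]
    exact (hM i i).trans (div_self' _)
  · apply powChar_injective
    rw [powChar_neg]
    exact (hM j i).trans ((congrArg _ (hM i j)).trans (inv_div _ _)).symm
  -- If a kills M, then the a-th power kills every commutator, in particular q; hence a = 0 modulo
  -- the order of q.
  · have h1 : commutatorGroup K A ≤ (powMonoidHom a.val : Kˣ →* Kˣ).ker := by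
      rw [hb.commutatorGroup_eq, Subgroup.closure_le]
      rintro _ ⟨x, y, rfl⟩
      change (c x y / c y x) ^ a.val = 1
      rw [hP, ← powChar_mul, pairing, ← smul_eq_mul, ← dotProduct_smul, ← smul_mulVec, ha,
        zero_mulVec, dotProduct_zero, powChar_zero]
    have h2 : powChar q a = 1 := h1 (hq ▸ Subgroup.mem_zpowers q)
    exact powChar_injective (h2.trans powChar_zero.symm)

/-- Isomorphy of quantum tori in terms of the matrices of their commutator pairings. -/
theorem IsTwistedBasis.nonempty_algEquiv_iff (hb : IsTwistedBasis b c) {B : Type*} [Ring B]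
    [Algebra K B] {b' : Basis (Fin n → ℤ) K B} {c' : (Fin n → ℤ) → (Fin n → ℤ) → Kˣ}
    (hb' : IsTwistedBasis b' c') {M M' : Matrix (Fin n) (Fin n) (ZMod (orderOf q))}
    (hM : HasPairing q c M) (hM' : HasPairing q c' M') :
    Nonempty (A ≃ₐ[K] B) ↔ ∃ G : GL (Fin n) ℤ, congruence (reduceGL (orderOf q) G) M = M' := by
  -- Pulling back along ψ carries M' to M, so the reversed congruence is the natural one to prove.
  have key : (∃ G : GL (Fin n) ℤ, congruence (reduceGL (orderOf q) G) M' = M) ↔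
      ∃ G : GL (Fin n) ℤ, congruence (reduceGL (orderOf q) G) M = M' := by
    constructor <;> rintro ⟨G, hG⟩ <;> exact ⟨G⁻¹, by rw [map_inv]; exact congruence_inv hG⟩
  rw [← key]
  constructor
  · rintro ⟨φ⟩
    obtain ⟨ψ, -, hψ⟩ := hb.exists_addEquiv_of_algEquiv hb' φ
    let f := (Pi.basisFun ℤ (Fin n)).map ψ.toIntLinearEquiv
    let e := Pi.basisFun ℤ (Fin n)
    -- The rows of G are the images under ψ of the standard basis vectors.
    let G : GL (Fin n) ℤ := ⟨(e.toMatrix f)ᵀ, (f.toMatrix e)ᵀ,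
      by rw [← transpose_mul, Module.Basis.toMatrix_mul_toMatrix_flip, transpose_one],
      by rw [← transpose_mul, Module.Basis.toMatrix_mul_toMatrix_flip, transpose_one]⟩
    refine ⟨G, ?_⟩
    have hG : ∀ i, (Pi.single i 1 : Fin n → ℤ) ᵥ* (G : Matrix (Fin n) (Fin n) ℤ) =
        ψ (Pi.single i 1) := fun i => by
      ext j
      simp [G, f, e, Basis.toMatrix_apply]
    ext i j
    rw [← pairing_single (congruence _ M'), pairing_congruence, hG, hG]
    apply powChar_injective
    rw [← hM', hψ, hM, pairing_single]
  · rintro ⟨G, hG⟩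
    let ψ : (Fin n → ℤ) ≃+ (Fin n → ℤ) :=
      { toFun := fun x => x ᵥ* (G : Matrix (Fin n) (Fin n) ℤ)
        invFun := fun x => x ᵥ* ((G⁻¹ : GL (Fin n) ℤ) : Matrix (Fin n) (Fin n) ℤ)
        left_inv := fun x => by
          simp only
          rw [vecMul_vecMul, ← Units.val_mul, mul_inv_cancel, Units.val_one, vecMul_one]
        right_inv := fun x => by
          simp only
          rw [vecMul_vecMul, ← Units.val_mul, inv_mul_cancel, Units.val_one, vecMul_one]
        map_add' := fun x y => add_vecMul _ _ _ }
    obtain ⟨φ, -⟩ := hb.exists_algEquiv_of_addEquiv hb' ψ fun x y => by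
      rw [hM', hM, ← hG, pairing_congruence]
      rfl
    exact ⟨φ⟩

end Pairing

/-! ### The model algebras -/

section Model

open Module Matrix

variable {K : Type*} [Field K] {n : ℕ}

/-- The identification `(ℤ²)ˢ × ℤ^{n-2s} ≅ ℤⁿ`. -/
def indexEquiv {s : ℕ} (hs : 2 * s ≤ n) :
    ((Fin s → ℤ × ℤ) × (Fin (n - 2 * s) → ℤ)) ≃+ (Fin n → ℤ) where
  toFun γ i := if h : i.val < 2 * s then
      if i.val % 2 = 0 then (γ.1 ⟨i.val / 2, by omega⟩).1 else (γ.1 ⟨i.val / 2, by omega⟩).2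
    else γ.2 ⟨i.val - 2 * s, by omega⟩
  invFun x := (fun k => (x ⟨2 * k.val, by omega⟩, x ⟨2 * k.val + 1, by omega⟩),
    fun k => x ⟨2 * s + k.val, by omega⟩)
  left_inv γ := by
    refine Prod.ext (funext fun k => Prod.ext ?_ ?_) (funext fun k => ?_)
    · have h1 : 2 * k.val < 2 * s := by omega
      simp [h1]
    · have h1 : 2 * k.val + 1 < 2 * s := by omega
      have h2 : (2 * k.val + 1) / 2 = k.val := by omega
      have h3 : (2 * k.val + 1) % 2 = 1 := by omega
      simp [h1, h2, h3]
    · simp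
  right_inv x := by
    ext i
    by_cases h : i.val < 2 * s
    · simp only [h, dif_pos]
      split_ifs with h2
      · congr 1; exact Fin.ext (by simp; omega)
      · congr 1; exact Fin.ext (by simp; omega)
    · simp only [h, dif_neg, not_false_eq_true]
      congr 1; exact Fin.ext (by simp; omega)
  map_add' γ δ := by
    ext i
    simp only [Prod.fst_add, Prod.snd_add, Pi.add_apply]
    split_ifs <;> rfl

theorem pairing_blockMatrix {m s : ℕ} (hs : 2 * s ≤ n) (h : Fin s → ZMod m) (x y : Fin n → ℤ) :
    pairing (blockMatrix n h) x y = ∑ k : Fin s,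
      ((x ⟨2 * k.val, by omega⟩ * y ⟨2 * k.val + 1, by omega⟩ -
        x ⟨2 * k.val + 1, by omega⟩ * y ⟨2 * k.val, by omega⟩ : ℤ) : ZMod m) * h k := by
  have hN : blockMatrix n h = ∑ k : Fin s,
      (single ⟨2 * k.val, by omega⟩ ⟨2 * k.val + 1, by omega⟩ (h k) -
        single ⟨2 * k.val + 1, by omega⟩ ⟨2 * k.val, by omega⟩ (h k)) := by
    ext i j
    rw [blockMatrix, Matrix.sum_apply]
    refine Finset.sum_congr rfl fun k _ => ?_
    rw [Matrix.sub_apply, single_apply, single_apply]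
    simp only [Fin.ext_iff, eq_comm]
  rw [pairing, hN, sum_mulVec, dotProduct_sum]
  refine Finset.sum_congr rfl fun k _ => ?_
  have hs : ∀ (i j : Fin n) (a : ZMod m) (u v : Fin n → ZMod m),
      u ⬝ᵥ single i j a *ᵥ v = u i * v j * a := fun i j a u v => by
    rw [dotProduct, Finset.sum_eq_single i]
    · rw [mulVec, dotProduct, Finset.sum_eq_single j]
      · rw [single_apply_same]; ring
      · intro l _ hl
        simp [Ne.symm hl]
      · simp
    · intro l _ hl
      simp [mulVec, dotProduct, Ne.symm hl]
    · simp
  rw [sub_mulVec, dotProduct_sub, hs, hs]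
  push_cast
  ring

theorem IsTwistedBasis.tensorProduct {A B Γ Δ : Type*} [Ring A] [Algebra K A] [Ring B]
    [Algebra K B] [AddCommGroup Γ] [AddCommGroup Δ] {b : Basis Γ K A} {c : Γ → Γ → Kˣ}
    (hb : IsTwistedBasis b c) {b' : Basis Δ K B} {c' : Δ → Δ → Kˣ} (hb' : IsTwistedBasis b' c') :
    IsTwistedBasis (A := A ⊗[K] B) (b.tensorProduct b')
      fun x y => c x.1 y.1 * c' x.2 y.2 := fun x y => by
  rw [Basis.tensorProduct_apply', Basis.tensorProduct_apply', Basis.tensorProduct_apply',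
    Algebra.TensorProduct.tmul_mul_tmul, hb, hb', Units.smul_def, Units.smul_def, Units.smul_def,
    TensorProduct.smul_tmul_smul, Units.val_mul]
  rfl

theorem IsTwistedBasis.piTensorProduct {ι : Type*} [Fintype ι] {A Γ : ι → Type*}
    [∀ i, Ring (A i)] [∀ i, Algebra K (A i)] [∀ i, AddCommGroup (Γ i)]
    {b : ∀ i, Basis (Γ i) K (A i)} {c : ∀ i, Γ i → Γ i → Kˣ}
    (hb : ∀ i, IsTwistedBasis (b i) (c i)) :
    IsTwistedBasis (A := ⨂[K] i, A i) (Basis.piTensorProduct b)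
      fun x y => ∏ i, c i (x i) (y i) := fun x y => by
  rw [Basis.piTensorProduct_apply, Basis.piTensorProduct_apply, Basis.piTensorProduct_apply,
    PiTensorProduct.tprod_mul_tprod]
  have : ((fun i => b i (x i)) * fun i => b i (y i)) = fun i =>
      ((c i (x i) (y i) : Kˣ) : K) • b i ((x + y) i) := funext fun i => hb i _ _
  rw [this, MultilinearMap.map_smul_univ, Units.smul_def, Units.coe_prod]

theorem PlaneTorus.isTwistedBasis (q : Kˣ) :
    IsTwistedBasis (PlaneTorus.basis q) fun x y => q ^ (x.1 * y.2) := fun x y => by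
  rw [PlaneTorus.basis_apply, PlaneTorus.basis_apply, PlaneTorus.basis_apply]
  exact PlaneTorus.delta_mul_delta q x y

theorem isTwistedBasis_addMonoidAlgebra (Γ : Type*) [AddCommGroup Γ] :
    IsTwistedBasis (A := AddMonoidAlgebra K Γ) (AddMonoidAlgebra.basis Γ K) fun _ _ => 1 :=
  fun x y => by
    rw [AddMonoidAlgebra.basis_apply, AddMonoidAlgebra.basis_apply, AddMonoidAlgebra.basis_apply,
      AddMonoidAlgebra.single_mul_single, mul_one, one_smul]

theorem IsTwistedBasis.reindex {A Γ Δ : Type*} [Ring A] [Algebra K A] [AddCommGroup Γ]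
    [AddCommGroup Δ] {b : Basis Γ K A} {c : Γ → Γ → Kˣ} (hb : IsTwistedBasis b c) (e : Γ ≃+ Δ) :
    IsTwistedBasis (b.reindex e.toEquiv) fun x y => c (e.symm x) (e.symm y) := fun x y => by
  rw [Basis.reindex_apply, Basis.reindex_apply, Basis.reindex_apply]
  change b (e.symm x) * b (e.symm y) = _ • b (e.symm (x + y))
  rw [hb, map_add e.symm]

namespace NormalFormData

variable (q : Kˣ)

/-- The model algebra is a twisted group algebra of `ℤⁿ`, with commutator pairing given by the
block matrix of the exponents. -/
theorem exists_isTwistedBasis_model [NeZero (orderOf q)] (d : NormalFormData n (orderOf q)) :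
    ∃ (b : Basis (Fin n → ℤ) K (d.Model q)) (c : (Fin n → ℤ) → (Fin n → ℤ) → Kˣ),
      IsTwistedBasis (A := d.Model q) b c ∧ HasPairing q c (blockMatrix n d.exponent) ∧
      ∀ γ, d.modelGrading q γ = Submodule.span K {b (indexEquiv d.two_mul_le γ)} := by
  let θ := indexEquiv d.two_mul_le
  have h := ((IsTwistedBasis.piTensorProduct fun i => PlaneTorus.isTwistedBasis
    (d.param q i)).tensorProduct (isTwistedBasis_addMonoidAlgebra (K := K)
    (Fin (n - 2 * d.s) → ℤ))).reindex θ
  refine ⟨_, _, h, fun x y => ?_, fun γ => ?_⟩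
  · simp only [mul_one]
    rw [pairing_blockMatrix d.two_mul_le, powChar_sum, ← Finset.prod_div_distrib]
    refine Finset.prod_congr rfl fun k _ => ?_
    rw [powChar_intCast_mul, _root_.zpow_sub, div_eq_mul_inv]
    have h : powChar q (d.exponent k) = d.param q k := rfl
    rw [h]
    congr 3
    exact mul_comm _ _
  · rw [Basis.reindex_apply]
    have hθ : θ.toEquiv.symm (indexEquiv d.two_mul_le γ) = γ := θ.symm_apply_apply γ
    rw [hθ, Basis.tensorProduct_apply', Basis.piTensorProduct_apply]
    simp only [PlaneTorus.basis_apply, AddMonoidAlgebra.basis_apply]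
    rfl

/-- The order of q ^ x is governed by the annihilator of x in ℤ/m, which the unit z does not change.
-/
theorem orderOf_param [NeZero (orderOf q)] (d : NormalFormData n (orderOf q)) (i : Fin d.s) :
    orderOf (d.param q i) = orderOf (q ^ (d.h i).val) := by
  rw [orderOf_eq_orderOf_iff]
  intro k
  have h : ∀ x : ZMod (orderOf q), (q ^ x.val) ^ k = 1 ↔ (k : ZMod (orderOf q)) * x = 0 := by
    intro x
    have h1 : powChar q ((k : ZMod (orderOf q)) * x) = (q ^ x.val) ^ k := by
      have := powChar_intCast_mul (q := q) (k : ℤ) x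
      rwa [Int.cast_natCast, zpow_natCast] at this
    rw [← h1, ← powChar_zero (q := q), powChar_injective.eq_iff]
  rw [param, h, h, exponent]
  split_ifs
  · rw [mul_left_comm, Units.mul_right_eq_zero]
  · rfl

end NormalFormData

end Model

/-! ### Rational quantum tori -/

section Rational

open Module

variable {K : Type*} [Field K] {n : ℕ} {A : Type*} [Ring A] [Algebra K A]
  {b : Basis (Fin n → ℤ) K A} {c : (Fin n → ℤ) → (Fin n → ℤ) → Kˣ}

/-- By bimultiplicativity, C_A is generated by the finitely many pairings of standard basis vectors.
Each is a root of unity, so the product of their orders is a common exponent. -/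
theorem IsTwistedBasis.exists_commutatorGroup_le_rootsOfUnity (hb : IsTwistedBasis b c)
    (hA : IsRational K A) : ∃ N : ℕ, N ≠ 0 ∧ commutatorGroup K A ≤ rootsOfUnity N K := by
  set ζ : Fin n → Fin n → Kˣ := fun i j =>
    c (Pi.single i 1) (Pi.single j 1) / c (Pi.single j 1) (Pi.single i 1) with hζ
  have hfin : ∀ i j, 0 < orderOf (ζ i j) := fun i j => by
    obtain ⟨ξ, hξ, he⟩ := hA _ (hb.mem_commutatorGroup (Pi.single i 1) (Pi.single j 1))
    rw [hζ]
    simp only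
    rw [← scalarUnits_injective b he]
    exact hξ.orderOf_pos
  refine ⟨∏ i, ∏ j, orderOf (ζ i j),
    Finset.prod_ne_zero_iff.mpr fun i _ =>
      Finset.prod_ne_zero_iff.mpr fun j _ => (hfin i j).ne', ?_⟩
  rw [hb.commutatorGroup_eq, Subgroup.closure_le]
  rintro _ ⟨x, y, rfl⟩
  rw [hb.div_eq_prod]
  refine Subgroup.prod_mem _ fun i _ => Subgroup.prod_mem _ fun j _ =>
    Subgroup.zpow_mem _ (Subgroup.zpow_mem _ ?_ _) _
  rw [mem_rootsOfUnity]
  change ζ i j ^ _ = 1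
  rw [← orderOf_dvd_iff_pow_eq_one]
  exact (Finset.dvd_prod_of_mem (fun j => orderOf (ζ i j)) (Finset.mem_univ j)).trans
    (Finset.dvd_prod_of_mem (fun i => ∏ j, orderOf (ζ i j)) (Finset.mem_univ i))

theorem IsTwistedBasis.isCyclic_commutatorGroup (hb : IsTwistedBasis b c) (hA : IsRational K A) :
    IsCyclic (commutatorGroup K A) := by
  obtain ⟨N, hN, hle⟩ := hb.exists_commutatorGroup_le_rootsOfUnity hA
  have : NeZero N := ⟨hN⟩
  have : Finite (commutatorGroup K A) :=
    Finite.of_injective _ (Subgroup.inclusion_injective hle)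
  -- A finite subgroup of the unit group of a field is cyclic.
  infer_instance

theorem IsTwistedBasis.orderOf_pos (hb : IsTwistedBasis b c) (hA : IsRational K A) {q : Kˣ}
    (hq : Subgroup.zpowers q = commutatorGroup K A) : 0 < orderOf q := by
  obtain ⟨N, hN, hle⟩ := hb.exists_commutatorGroup_le_rootsOfUnity hA
  exact orderOf_pos_iff.mpr (isOfFinOrder_iff_pow_eq_one.mpr
    ⟨N, Nat.pos_of_ne_zero hN, hle (hq ▸ Subgroup.mem_zpowers q)⟩)

theorem IsTwistedBasis.orderOf_eq_one (hb : IsTwistedBasis b c) (hn : n = 0) {q : Kˣ}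
    (hq : Subgroup.zpowers q = commutatorGroup K A) : orderOf q = 1 := by
  subst hn
  have h : commutatorGroup K A ≤ ⊥ := by
    rw [hb.commutatorGroup_eq, Subgroup.closure_le]
    rintro _ ⟨x, y, rfl⟩
    rw [Subsingleton.elim x y]
    exact div_self' _
  rw [orderOf_eq_one_iff]
  exact h (hq ▸ Subgroup.mem_zpowers q)

/-- An algebra isomorphism carries the commutator group over. -/
theorem commutatorGroup_le_of_algEquiv {B : Type*} [Ring B] [Algebra K B] (φ : A ≃ₐ[K] B) :
    commutatorGroup K A ≤ commutatorGroup K B := by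
  intro ζ hζ
  let f : Aˣ →* Bˣ := Units.map (φ : A →* B)
  have h1 : f (scalarUnits K A ζ) ∈ (commutator Aˣ).map f := ⟨_, hζ, rfl⟩
  have h2 : f (scalarUnits K A ζ) = scalarUnits K B ζ := Units.ext (φ.commutes _)
  rw [h2] at h1
  refine (?_ : (commutator Aˣ).map f ≤ commutator Bˣ) h1
  rw [commutator_def, commutator_def, Subgroup.map_commutator]
  exact Subgroup.commutator_mono le_top le_top

theorem commutatorGroup_eq_of_algEquiv {B : Type*} [Ring B] [Algebra K B] (φ : A ≃ₐ[K] B) :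
    commutatorGroup K A = commutatorGroup K B :=
  le_antisymm (commutatorGroup_le_of_algEquiv φ) (commutatorGroup_le_of_algEquiv φ.symm)

theorem IsTwistedBasis.map {B Γ : Type*} [Ring B] [Algebra K B] [AddCommGroup Γ] {b : Basis Γ K A}
    {c : Γ → Γ → Kˣ} (hb : IsTwistedBasis b c) (φ : A ≃ₐ[K] B) :
    IsTwistedBasis (b.map φ.toLinearEquiv) c := fun x y => by
  have h := congrArg φ (hb x y)
  rw [map_mul, Units.smul_def, map_smul] at h
  exact h

/-- A quantum torus is graded isomorphic to a model. -/
theorem IsQuantumTorus.exists_gradedIsomorphic_model {𝒜 : (Fin n → ℤ) → Submodule K A}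
    [GradedAlgebra 𝒜] (hQ : IsQuantumTorus K 𝒜) {q : Kˣ} [NeZero (orderOf q)]
    (hq : Subgroup.zpowers q = commutatorGroup K A) : ∃ d : NormalFormData n (orderOf q),
      GradedIsomorphic (B := d.Model q) 𝒜 (d.modelGrading q) := by
  obtain ⟨b, c, hb, h𝒜⟩ := hQ.exists_isTwistedBasis
  obtain ⟨M, hdiag, hskew, hgen, hM⟩ := hb.exists_hasPairing hq
  obtain ⟨P, d, hP⟩ := exists_congruence_exponent (NeZero.ne _) M hdiag hskew hgen
  obtain ⟨b', c', hb', hM', hgr⟩ := d.exists_isTwistedBasis_model q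
  obtain ⟨φ⟩ := (hb.nonempty_algEquiv_iff hb' hM hM').mpr ⟨P, hP⟩
  -- φ is known only as an algebra isomorphism; its compatibility with the gradings comes from the
  -- homogeneity of units.
  obtain ⟨ψ, hψ, -⟩ := hb.exists_addEquiv_of_algEquiv hb' φ
  refine ⟨d, φ, ψ.trans (indexEquiv d.two_mul_le).symm, fun γ => ?_⟩
  rw [h𝒜, hψ, hgr]
  simp

/-- Isomorphy of algebras with given models. -/
theorem NormalFormData.nonempty_algEquiv_iff {B : Type*} [Ring B] [Algebra K B] {q : Kˣ}
    [NeZero (orderOf q)] (hn : n = 0 → orderOf q = 1) (d d' : NormalFormData n (orderOf q))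
    (hA : Nonempty (A ≃ₐ[K] d.Model q)) (hB : Nonempty (B ≃ₐ[K] d'.Model q)) :
    Nonempty (A ≃ₐ[K] B) ↔ d.Related d' := by
  obtain ⟨φ⟩ := hA
  obtain ⟨φ'⟩ := hB
  obtain ⟨b, c, hb, hM, -⟩ := d.exists_isTwistedBasis_model q
  obtain ⟨b', c', hb', hM', -⟩ := d'.exists_isTwistedBasis_model q
  rw [(hb.map φ.symm).nonempty_algEquiv_iff (hb'.map φ'.symm) hM hM',
    exists_congruence_iff_related hn]

theorem NormalFormData.Related.sq_mul_eq {m : ℕ} (hm : m ≠ 0) {d d' : NormalFormData n m}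
    (h : d.Related d') {i : Fin d.s} (hi : i.val + 1 = d.s) :
    (d.z : ZMod m) ^ 2 * d.h i = (d'.z : ZMod m) ^ 2 * d.h i := by
  obtain ⟨hs, -, e, he, hz⟩ := h
  rcases d.two_mul_le.lt_or_eq with hlt | heq
  · rw [d.z_eq_one hlt, d'.z_eq_one (hs ▸ hlt)]
  · have h1 : (d'.z : ZMod m) ^ 2 = (d.z : ZMod m) ^ 2 * (e : ZMod m) ^ 2 := by
      rcases hz with hz | hz <;> rw [hz] <;> push_cast <;> ring
    rw [h1, mul_assoc, sq_mul_eq_of_mem_detGroup heq hm d.h_mem d.h_dvd he hi]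

/-- For quantum tori, isomorphy as algebras and graded isomorphy are the same. -/
theorem IsQuantumTorus.gradedIsomorphic_iff {B : Type*} [Ring B] [Algebra K B]
    {𝒜 : (Fin n → ℤ) → Submodule K A} [GradedAlgebra 𝒜] (hA : IsQuantumTorus K 𝒜)
    {ℬ : (Fin n → ℤ) → Submodule K B} [GradedAlgebra ℬ] (hB : IsQuantumTorus K ℬ) :
    GradedIsomorphic 𝒜 ℬ ↔ Nonempty (A ≃ₐ[K] B) := by
  refine ⟨fun ⟨φ, _⟩ => ⟨φ⟩, fun ⟨φ⟩ => ?_⟩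
  obtain ⟨b, c, hb, h𝒜⟩ := hA.exists_isTwistedBasis
  obtain ⟨b', c', hb', hℬ⟩ := hB.exists_isTwistedBasis
  obtain ⟨ψ, hψ, -⟩ := hb.exists_addEquiv_of_algEquiv hb' φ
  exact ⟨φ, ψ, fun γ => by rw [h𝒜, hψ, hℬ]⟩

end Rational

end RationalQuantumTori

end
-- Assembly of the normal form theorem.
open RationalQuantumTori in
theorem mainTheorem1 {K : Type*} [Field K] (n : ℕ) :
    -- (a)
    (∀ {A : Type*} [Ring A] [Algebra K A] (𝒜 : (Fin n → ℤ) → Submodule K A) [GradedAlgebra 𝒜],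
      IsQuantumTorus K 𝒜 → IsRational K A →
        IsCyclic (commutatorGroup K A) ∧
        ∀ q : Kˣ, Subgroup.zpowers q = commutatorGroup K A →
          0 < orderOf q ∧
          ∃ d : NormalFormData n (orderOf q),
            GradedIsomorphic (B := d.Model q) 𝒜 (d.modelGrading q) ∧
            ∀ i, orderOf (d.param q i) = orderOf (q ^ (d.h i).val)) ∧
    -- (b) and (c)
    (∀ {A A' : Type*} [Ring A] [Algebra K A] [Ring A'] [Algebra K A']
      (𝒜 : (Fin n → ℤ) → Submodule K A) [GradedAlgebra 𝒜]
      (𝒜' : (Fin n → ℤ) → Submodule K A') [GradedAlgebra 𝒜'],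
      IsQuantumTorus K 𝒜 → IsRational K A → IsQuantumTorus K 𝒜' → IsRational K A' →
        (Nonempty (A ≃ₐ[K] A') →
          commutatorGroup K A = commutatorGroup K A' ∧
          ∀ q : Kˣ, Subgroup.zpowers q = commutatorGroup K A →
            (∃ d : NormalFormData n (orderOf q), GradedIsomorphic (B := d.Model q) 𝒜 (d.modelGrading q)) ∧
            ∃ d' : NormalFormData n (orderOf q), GradedIsomorphic (B := d'.Model q) 𝒜' (d'.modelGrading q)) ∧
        (∀ q : Kˣ, Subgroup.zpowers q = commutatorGroup K A →
          Subgroup.zpowers q = commutatorGroup K A' →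
          ∀ d d' : NormalFormData n (orderOf q),
            Nonempty (A ≃ₐ[K] d.Model q) → Nonempty (A' ≃ₐ[K] d'.Model q) →
              (Nonempty (A ≃ₐ[K] A') ↔ d.Related d') ∧
              (GradedIsomorphic 𝒜 𝒜' ↔ d.Related d') ∧
              (d.Related d' → ∀ i : Fin d.s, i.val + 1 = d.s →
                (d.z : ZMod (orderOf q)) ^ 2 * d.h i
                  = (d'.z : ZMod (orderOf q)) ^ 2 * d.h i))) := by
  refine ⟨fun 𝒜 _ hQ hR => ?_, fun 𝒜 _ 𝒜' _ hQ hR hQ' hR' => ⟨?_, ?_⟩⟩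
  · obtain ⟨b, c, hb, -⟩ := hQ.exists_isTwistedBasis
    refine ⟨hb.isCyclic_commutatorGroup hR, fun q hq => ⟨hb.orderOf_pos hR hq, ?_⟩⟩
    have : NeZero (orderOf q) := ⟨(hb.orderOf_pos hR hq).ne'⟩
    obtain ⟨d, hd⟩ := hQ.exists_gradedIsomorphic_model hq
    exact ⟨d, hd, d.orderOf_param q⟩
  · rintro ⟨φ⟩
    have hC := commutatorGroup_eq_of_algEquiv φ
    refine ⟨hC, fun q hq => ?_⟩
    obtain ⟨b, c, hb, -⟩ := hQ.exists_isTwistedBasis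
    have : NeZero (orderOf q) := ⟨(hb.orderOf_pos hR hq).ne'⟩
    exact ⟨hQ.exists_gradedIsomorphic_model hq, hQ'.exists_gradedIsomorphic_model (hq.trans hC)⟩
  · intro q hq _ d d' hd hd'
    obtain ⟨b, c, hb, -⟩ := hQ.exists_isTwistedBasis
    have hpos := hb.orderOf_pos hR hq
    have : NeZero (orderOf q) := ⟨hpos.ne'⟩
    have hiff := d.nonempty_algEquiv_iff (fun hn => hb.orderOf_eq_one hn hq) d' hd hd'
    exact ⟨hiff, (hQ.gradedIsomorphic_iff hQ').trans hiff, fun h _ hi => h.sq_mul_eq hpos.ne' hi⟩
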